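/- **Liveness of Block-STM.** Finitely many threads run the Block-STM algorithm described below on a block of $n$ transactions $tx_0,\dots,tx_{n-1}$. Suppose that every thread keeps taking steps until it joins (a thread that has not joined by time $T$ takes a step at or after time $T$) and that $\mathrm{VM.execute}$ is wait-free (in every run of the algorithm, whatever the other threads do, a thread that keeps taking steps returns from each invocation of $\mathrm{VM.execute}$ after finitely many steps of its own). Then every thread eventually joins; in particular there is neither deadlock nor livelock. *The algorithm.* A run is a global sequence of atomic steps of the threads: each access to a shared variable, each locking or unlocking, and each instruction of a transaction is one step; a thread that tries to take a lock that is held retries at its next step. "Under lock" means that the lock is taken before and released after the described accesses. Loops over sets use an arbitrary order. A version is a pair $(j,i)$ of a transaction index and an incarnation number. Shared variables (initial values): a map $\mathit{data}$ from pairs (location, index) to pairs (incarnation, value) or the marker ESTIMATE (empty); for each $j<n$, a set $\mathit{locs}[j]$ of locations ($\emptyset$), a set $\mathit{reads}[j]$ of pairs (location, version or $\bot$) ($\emptyset$), a pair $\mathit{status}[j]$ of an incarnation number and one of READY, EXECUTING, EXECUTED, ABORTING ($(0,\text{READY})$) and a set $\mathit{dep}[j]$ of indices ($\emptyset$), the last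 two each with a lock of its own; counters $E$ (execution index), $V$ (validation index), $C$ (number of decreases), $A$ (number of active tasks), all $0$; a flag $\mathit{done}$ (false). - **read**$(l,j)$ (atomic): let $i<j$ be the largest index for which $\mathit{data}$ has an entry at $(l,i)$. The result is NOT_FOUND if there is none, READ_ERROR with blocking index $i$ if the entry is ESTIMATE, and otherwise OK with the version $(i,\text{incarnation})$ and the value of the entry. - **VM.execute**$(j)$: run the program of $tx_j$, an arbitrary deterministic program over the values that it reads, collecting a read-set $R$ and a write-set $W$, initially empty. Writes only change $W$, which keeps the latest value per location. A read of $l$ returns the value in $W$ if $W$ contains $l$; otherwise it performs read$(l,j)$: on NOT_FOUND it adds $(l,\bot)$ to $R$ and returns the value that the fixed storage holds at $l$; on OK it adds $(l,\text{version})$ to $R$ and returns the value; on READ_ERROR the execution stops and returns the blocking index. When the program halts, return $(R,W)$. - **run**: with $\mathit{task}=\bot$, repeat until $\mathit{done}$ is read to be true at the start of an iteration, and then join: if $\mathit{task}$ is an execution task, $\mathit{task}\gets$ try_execute; then, if $\mathit{task}$ is a validation task, $\mathit{task}\gets$ needs_reexecution; then, if $\mathit{task}=\bot$, $\mathit{task}\gets$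 next_task. - **try_execute**$(j,i)$: call VM.execute$(j)$. If it returns a blocking index $b$: take the lock of $\mathit{dep}[b]$; read $\mathit{status}[b]$ under its lock; if it is EXECUTED, release the lock of $\mathit{dep}[b]$ and start try_execute$(j,i)$ again; otherwise set $\mathit{status}[j]$ to ABORTING under its lock, insert $j$ into $\mathit{dep}[b]$, release the lock of $\mathit{dep}[b]$, decrement $A$ and return $\bot$. If it returns $(R,W)$: set $\mathit{data}[l,j]\gets(i,x)$ for all $(l,x)\in W$; let $L$ be the set of locations in $W$; read $P\gets\mathit{locs}[j]$; remove $\mathit{data}[l,j]$ for all $l\in P\setminus L$; set $\mathit{locs}[j]\gets L$, then $\mathit{reads}[j]\gets R$; set $\mathit{status}[j]$ to EXECUTED under its lock; under the lock of $\mathit{dep}[j]$ swap that set, of value $D$, with $\emptyset$; call set_ready$(d)$ for all $d\in D$; if $D\ne\emptyset$, set $E\gets\min(E,\min D)$ and then increment $C$. Then read $V$: if $V>j$ and $L\setminus P=\emptyset$, return the validation task $(j,i)$; if $V>j$ and $L\setminus P\neq\emptyset$, set $V\gets\min(V,j)$ and then increment $C$. Finally decrement $A$ and return $\bot$. - **set_ready**$(j)$: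 under its lock, change $\mathit{status}[j]$ from $(i,\cdot)$ to $(i+1,\text{READY})$. - **needs_reexecution**$(j,i)$: read $\mathit{reads}[j]$, then test each $(l,v)$ in it with read$(l,j)$; the test fails on READ_ERROR, on NOT_FOUND with $v\ne\bot$, and on OK with a version other than $v$. At the first failure, under the lock of $\mathit{status}[j]$: if $\mathit{status}[j]=(i,\text{EXECUTED})$, set it to ABORTING; we say that the validation aborts. If it does not abort, decrement $A$ and return $\bot$. If it aborts: read $\mathit{locs}[j]$ and set $\mathit{data}[l,j]\gets$ ESTIMATE for all $l$ in it; call set_ready$(j)$; set $V\gets\min(V,j+1)$; increment $C$; if $E>j$ and try_incarnate$(j)$ returns a version, return it as an execution task; otherwise decrement $A$ (once) and return $\bot$. - **try_incarnate**$(j)$: under the lock of $\mathit{status}[j]$, if the status is READY, set it to EXECUTING and return $(j,\text{incarnation})$; otherwise return $\bot$. - **next_task**: read $V$, then $E$. If $V<E$: if $V\ge n$ (read again), call check_done and return $\bot$; otherwise increment $A$ and fetch-and-increment $V$, obtaining $j$; if $j<n$ and $\mathit{status}[j]$, read under its lock, is $(i,\text{EXECUTED})$, return the validation task $(j,i)$;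 otherwise decrement $A$ and return $\bot$. If $V\ge E$: if $E\ge n$ (read again), call check_done and return $\bot$; otherwise increment $A$ and fetch-and-increment $E$, obtaining $j$; if $j<n$ and try_incarnate$(j)$ returns a version, return it as an execution task; otherwise decrement $A$ and return $\bot$. - **check_done**: read $C$, then read $E$, $V$, $A$, $C$ in this order; if $E\ge n$, $V\ge n$, $A=0$ and $C$ has not changed, set $\mathit{done}\gets$ true. -/

import Mathlib

/-!
The Block-STM algorithm as a transition system.

`m` threads run the same procedure on a block of `n` transactions, with indices `0, …, n - 1`.
Every access to a shared variable, every acquisition and release of a lock and every instruction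
of the virtual machine is one atomic step of one thread.
-/

namespace BlockSTM

/-- A version: a transaction index and an incarnation number. -/
abbrev Version (n : ℕ) : Type := Fin n × ℕ

/-- Read descriptors: a location with the version read there, `none` for a read from storage. -/
abbrev ReadSet (n : ℕ) (Loc : Type*) : Type _ := Finset (Loc × Option (Version n))

/-- Pairs of a location and the value written to it. -/
abbrev WriteSet (Loc Val : Type*) : Type _ := Finset (Loc × Val)

/-! ### The virtual machine -/

/-- What a transaction does next, in a given local state of the virtual machine. -/
inductive Instr (Loc Val σ : Type*) where
  /-- finish the execution -/
  | halt
  /-- a local computation -/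
  | internal (next : σ)
  /-- write `x` at location `l` -/
  | write (l : Loc) (x : Val) (next : σ)
  /-- read location `l` and continue with the value that was read -/
  | read (l : Loc) (next : Val → σ)

/-- The input: the code of the `n` transactions, as programs of a virtual machine with local
states `σ`, and the contents of the storage before the block. -/
structure Block (n : ℕ) (Loc Val σ : Type*) where
  start : Fin n → σ
  instr : σ → Instr Loc Val σ
  storage : Loc → Val

/-! ### Shared memory -/

inductive Status where
  | readyToExecute
  | executing
  | executed
  | aborting
  deriving DecidableEq

/-- An entry of the multi-version memory. -/
inductive Entry (Val : Type*) where
  | value (incarnation : ℕ) (x : Val)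
  | estimate

/-- There is one lock per transaction for its status and one for its set of dependencies. -/
inductive Lock (n : ℕ) where
  | status (j : Fin n)
  | dependency (j : Fin n)
  deriving DecidableEq

/-- The shared variables, and the current holder of every lock. -/
structure Shared (m n : ℕ) (Loc Val : Type*) where
  data : Loc → Fin n → Option (Entry Val)
  lastWrittenLocations : Fin n → Finset Loc
  lastReadSet : Fin n → ReadSet n Loc
  executionIdx : ℕ
  validationIdx : ℕ
  decreaseCnt : ℕ
  numActiveTasks : ℤ
  doneMarker : Bool
  txnDependency : Fin n → Finset (Fin n)
  txnIncarnation : Fin n → ℕ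
  txnStatus : Fin n → Status
  holder : Lock n → Option (Fin m)

/-- The initial values of the shared variables. -/
def Shared.init (m n : ℕ) (Loc Val : Type*) : Shared m n Loc Val where
  data := fun _ _ => none
  lastWrittenLocations := fun _ => ∅
  lastReadSet := fun _ => ∅
  executionIdx := 0
  validationIdx := 0
  decreaseCnt := 0
  numActiveTasks := 0
  doneMarker := false
  txnDependency := fun _ => ∅
  txnIncarnation := fun _ => 0
  txnStatus := fun _ => .readyToExecute
  holder := fun _ => none

/-- The result of reading from the multi-version memory. -/
inductive ReadResult (n : ℕ) (Val : Type*) where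
  | notFound
  | ok (v : Version n) (x : Val)
  | readError (blocking : Fin n)

namespace Shared

variable {m n : ℕ} {Loc Val : Type*}

/-- The read of location `l` on behalf of transaction `j`: it returns the entry at `l` of the
highest transaction below `j` that has one. -/
def read (s : Shared m n Loc Val) (l : Loc) (j : Fin n) : ReadResult n Val :=
  let S : Finset (Fin n) := Finset.univ.filter fun i => i < j ∧ (s.data l i).isSome
  if h : S.Nonempty then
    let i := S.max' h
    match s.data l i with
    | some (.value inc x) => .ok (i, inc) x
    | some .estimate => .readError i
    | none => .notFound
  else .notFound

/-- Set the entry of transaction `j` at location `l` (remove it for `e = none`). -/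
def setData [DecidableEq Loc] (s : Shared m n Loc Val) (l : Loc) (j : Fin n)
    (e : Option (Entry Val)) : Shared m n Loc Val :=
  { s with data := Function.update s.data l (Function.update (s.data l) j e) }

/-- Set the status of transaction `j`, keeping its incarnation number. -/
def setStatus (s : Shared m n Loc Val) (j : Fin n) (a : Status) : Shared m n Loc Val :=
  { s with txnStatus := Function.update s.txnStatus j a }

/-- Set the lock `ℓ` to be held by the given thread, or by no thread. -/
def setHolder (s : Shared m n Loc Val) (ℓ : Lock n) (o : Option (Fin m)) : Shared m n Loc Val :=
  { s with holder := Function.update s.holder ℓ o }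

end Shared

/-- The test of one read descriptor against the result of a new read. -/
def readStillValid {n : ℕ} {Val : Type*} (descriptor : Option (Version n)) :
    ReadResult n Val → Prop
  | .readError _ => False
  | .notFound => descriptor = none
  | .ok v _ => descriptor = some v

/-! ### Program counters -/

inductive Task (n : ℕ) where
  | execution (v : Version n)
  | validation (v : Version n)

/-- Where a thread finds itself when it has decremented `num_active_tasks`: at the end of a call of
`next_task`, or at the end of an execution or a validation that returns no task. -/
inductive Origin where
  | nextTask
  | finishedTask

/-- The two callers of `set_ready_status`: `resume_dependencies`, with `rest` still to be set
ready out of `deps`, and `finish_validation` for an aborted version `v`. -/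
inductive ReadyCaller (n : ℕ) where
  | resumeDependencies (v : Version n) (wroteNew : Bool) (deps rest : Finset (Fin n))
  | finishValidation (v : Version n)

/-- The program counter of a thread, with its local variables: the step that it performs next. -/
inductive PC (n : ℕ) (Loc Val σ : Type*) where
  /- `run` : the loop condition, and the end of the procedure -/
  | loop (task : Option (Task n))
  | joined
  /- `next_task` : compare the two indices -/
  | nextTask
  | nextTaskCompare (validationIdx : ℕ)
  /- `next_version_to_validate` -/
  | nvvCheck
  | nvvIncrActive
  | nvvFetch
  | nvvLock (j : Fin n)
  | nvvRead (j : Fin n)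
  | nvvUnlock (j : Fin n) (result : Option (Version n))
  /- `next_version_to_execute` -/
  | nveCheck
  | nveIncrActive
  | nveFetch
  /- `try_incarnate` -/
  | incLock (j : Fin n) (o : Origin)
  | incCheck (j : Fin n) (o : Origin)
  | incSet (j : Fin n) (o : Origin)
  | incGet (j : Fin n) (o : Origin)
  | incUnlock (j : Fin n) (o : Origin) (result : Option (Version n))
  /- decrement `num_active_tasks` and return no task -/
  | decrActive (o : Origin)
  /- `check_done` -/
  | cdCount
  | cdExecutionIdx (observed : ℕ)
  | cdValidationIdx (observed : ℕ)
  | cdActive (observed : ℕ)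
  | cdRecount (observed : ℕ)
  | cdSet
  /- `try_execute` : inside `VM.execute`, with the local state and the sets so far -/
  | vm (v : Version n) (state : σ) (R : ReadSet n Loc) (W : WriteSet Loc Val)
  /- `add_dependency` -/
  | adLockDep (v : Version n) (b : Fin n)
  | adLockBlocking (v : Version n) (b : Fin n)
  | adReadBlocking (v : Version n) (b : Fin n)
  | adUnlockBlocking (v : Version n) (b : Fin n) (resolved : Bool)
  | adUnlockRetry (v : Version n) (b : Fin n)
  | adLockStatus (v : Version n) (b : Fin n)
  | adSetAborting (v : Version n) (b : Fin n)
  | adUnlockStatus (v : Version n) (b : Fin n)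
  | adInsert (v : Version n) (b : Fin n)
  | adUnlockDep (v : Version n) (b : Fin n)
  /- `record` -/
  | recWrite (v : Version n) (R : ReadSet n Loc) (W rest : WriteSet Loc Val)
  | recLoad (v : Version n) (R : ReadSet n Loc) (newLocs : Finset Loc)
  | recRemove (v : Version n) (R : ReadSet n Loc) (newLocs prevLocs rest : Finset Loc)
  | recStoreLocs (v : Version n) (R : ReadSet n Loc) (newLocs prevLocs : Finset Loc)
  | recStoreReads (v : Version n) (R : ReadSet n Loc) (wroteNew : Bool)
  /- `finish_execution` -/
  | feLockStatus (v : Version n) (wroteNew : Bool)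
  | feSetExecuted (v : Version n) (wroteNew : Bool)
  | feUnlockStatus (v : Version n) (wroteNew : Bool)
  | feLockDep (v : Version n) (wroteNew : Bool)
  | feSwap (v : Version n) (wroteNew : Bool)
  | feUnlockDep (v : Version n) (wroteNew : Bool) (deps : Finset (Fin n))
  | feCheckValidationIdx (v : Version n) (wroteNew : Bool)
  | feDecrValidationIdx (v : Version n)
  | feCountDecr (v : Version n)
  /- `resume_dependencies` -/
  | rdLoop (v : Version n) (wroteNew : Bool) (deps rest : Finset (Fin n))
  | rdDecrExecutionIdx (v : Version n) (wroteNew : Bool) (target : Fin n)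
  | rdCountDecr (v : Version n) (wroteNew : Bool)
  /- `set_ready_status` -/
  | srLock (j : Fin n) (c : ReadyCaller n)
  | srRead (j : Fin n) (c : ReadyCaller n)
  | srWrite (j : Fin n) (incarnation : ℕ) (c : ReadyCaller n)
  | srUnlock (j : Fin n) (c : ReadyCaller n)
  /- `validate_read_set`, called by `needs_reexecution` -/
  | vrLoad (v : Version n)
  | vrLoop (v : Version n) (rest : ReadSet n Loc)
  /- `try_validation_abort` -/
  | vaLock (v : Version n)
  | vaCheck (v : Version n)
  | vaSet (v : Version n)
  | vaUnlock (v : Version n) (aborted : Bool)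
  /- `convert_writes_to_estimates` -/
  | ceLoad (v : Version n)
  | ceLoop (v : Version n) (rest : Finset Loc)
  /- `finish_validation`, for an aborted version -/
  | fvDecrValidationIdx (v : Version n)
  | fvCountDecr (v : Version n)
  | fvCheckExecutionIdx (v : Version n)

section Step

variable {m n : ℕ} {Loc Val σ : Type*}

/-- Where the thread continues when no task was returned. -/
def Origin.continue : Origin → PC n Loc Val σ
  | .nextTask => .loop none
  | .finishedTask => .nextTask

/-- Where the thread continues after `set_ready_status`. -/
def ReadyCaller.continue : ReadyCaller n → PC n Loc Val σ
  | .resumeDependencies v w deps rest => .rdLoop v w deps rest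
  | .finishValidation v => .fvDecrValidationIdx v

/-- The beginning of `try_execute`, which invokes `VM.execute`. -/
def tryExecute (B : Block n Loc Val σ) (v : Version n) : PC n Loc Val σ :=
  .vm v (B.start v.1) ∅ ∅

/-- The body of the loop of `run`. -/
def dispatch (B : Block n Loc Val σ) : Option (Task n) → PC n Loc Val σ
  | none => .nextTask
  | some (.execution v) => tryExecute B v
  | some (.validation v) => .vrLoad v

/-- The call of `try_incarnate` for an index fetched from `execution_idx`. -/
def tryIncarnateFetched (i : ℕ) : PC n Loc Val σ :=
  if h : i < n then .incLock ⟨i, h⟩ .nextTask else .decrActive .nextTask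

/-- The rest of `next_version_to_validate` for an index fetched from `validation_idx`. -/
def tryValidateFetched (i : ℕ) : PC n Loc Val σ :=
  if h : i < n then .nvvLock ⟨i, h⟩ else .decrActive .nextTask

/-- Thread `t` tries to acquire the lock `ℓ`: it gets to `q` if the lock is free and stays at `p`
if it is taken. -/
def acquire (t : Fin m) (s : Shared m n Loc Val) (ℓ : Lock n) (p q : PC n Loc Val σ) :
    Set (Shared m n Loc Val × PC n Loc Val σ) :=
  match s.holder ℓ with
  | none => {(s.setHolder ℓ (some t), q)}
  | some _ => {(s, p)}

/-- The lock `ℓ` is released. -/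
def release (s : Shared m n Loc Val) (ℓ : Lock n) (q : PC n Loc Val σ) :
    Set (Shared m n Loc Val × PC n Loc Val σ) :=
  {(s.setHolder ℓ none, q)}

variable [DecidableEq Loc] [DecidableEq Val]

open Classical in
/-- The possible effects of the next step of thread `t` at program counter `p`, when the shared
variables are `s`: the new shared variables and the new program counter of `t`. A loop over a set
takes the elements in an arbitrary order. -/
noncomputable def next (B : Block n Loc Val σ) (t : Fin m) (s : Shared m n Loc Val) :
    PC n Loc Val σ → Set (Shared m n Loc Val × PC n Loc Val σ)
  | .loop task => {(s, if s.doneMarker then .joined else dispatch B task)}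
  | .joined => ∅
  -- next_task
  | .nextTask => {(s, .nextTaskCompare s.validationIdx)}
  | .nextTaskCompare i => {(s, if i < s.executionIdx then .nvvCheck else .nveCheck)}
  -- next_version_to_validate
  | .nvvCheck => {(s, if n ≤ s.validationIdx then .cdCount else .nvvIncrActive)}
  | .nvvIncrActive => {({ s with numActiveTasks := s.numActiveTasks + 1 }, .nvvFetch)}
  | .nvvFetch =>
      {({ s with validationIdx := s.validationIdx + 1 }, tryValidateFetched s.validationIdx)}
  | .nvvLock j => acquire t s (.status j) (.nvvLock j) (.nvvRead j)
  | .nvvRead j =>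
      {(s, .nvvUnlock j
        (if s.txnStatus j = .executed then some (j, s.txnIncarnation j) else none))}
  | .nvvUnlock j (some v) => release s (.status j) (.loop (some (.validation v)))
  | .nvvUnlock j none => release s (.status j) (.decrActive .nextTask)
  -- next_version_to_execute
  | .nveCheck => {(s, if n ≤ s.executionIdx then .cdCount else .nveIncrActive)}
  | .nveIncrActive => {({ s with numActiveTasks := s.numActiveTasks + 1 }, .nveFetch)}
  | .nveFetch =>
      {({ s with executionIdx := s.executionIdx + 1 }, tryIncarnateFetched s.executionIdx)}
  -- try_incarnate ; if it fails, then exactly one decrement of num_active_tasks follows, whether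
  -- the caller is next_version_to_execute or finish_validation
  | .incLock j o => acquire t s (.status j) (.incLock j o) (.incCheck j o)
  | .incCheck j o =>
      {(s, if s.txnStatus j = .readyToExecute then .incSet j o else .incUnlock j o none)}
  | .incSet j o => {(s.setStatus j .executing, .incGet j o)}
  | .incGet j o => {(s, .incUnlock j o (some (j, s.txnIncarnation j)))}
  | .incUnlock j _ (some v) => release s (.status j) (.loop (some (.execution v)))
  | .incUnlock j o none => release s (.status j) (.decrActive o)
  | .decrActive o => {({ s with numActiveTasks := s.numActiveTasks - 1 }, o.continue)}
  -- check_done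
  | .cdCount => {(s, .cdExecutionIdx s.decreaseCnt)}
  | .cdExecutionIdx c => {(s, if n ≤ s.executionIdx then .cdValidationIdx c else .loop none)}
  | .cdValidationIdx c => {(s, if n ≤ s.validationIdx then .cdActive c else .loop none)}
  | .cdActive c => {(s, if s.numActiveTasks = 0 then .cdRecount c else .loop none)}
  | .cdRecount c => {(s, if c = s.decreaseCnt then .cdSet else .loop none)}
  | .cdSet => {({ s with doneMarker := true }, .loop none)}
  -- VM.execute
  | .vm v a R W =>
      match B.instr a with
      | .halt => {(s, .recWrite v R W W)}
      | .internal a' => {(s, .vm v a' R W)}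
      | .write l x a' => {(s, .vm v a' R (insert (l, x) (W.filter fun w => w.1 ≠ l)))}
      | .read l k =>
          {q | (∃ x, (l, x) ∈ W ∧ q = (s, .vm v (k x) R W)) ∨
            ((∀ x, (l, x) ∉ W) ∧
              q = match s.read l v.1 with
                | .notFound => (s, .vm v (k (B.storage l)) (insert (l, none) R) W)
                | .ok u x => (s, .vm v (k x) (insert (l, some u) R) W)
                | .readError b => (s, .adLockDep v b))}
  -- add_dependency
  | .adLockDep v b => acquire t s (.dependency b) (.adLockDep v b) (.adLockBlocking v b)
  | .adLockBlocking v b => acquire t s (.status b) (.adLockBlocking v b) (.adReadBlocking v b)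
  | .adReadBlocking v b => {(s, .adUnlockBlocking v b (decide (s.txnStatus b = .executed)))}
  | .adUnlockBlocking v b r =>
      release s (.status b) (if r then .adUnlockRetry v b else .adLockStatus v b)
  | .adUnlockRetry v b => release s (.dependency b) (tryExecute B v)
  | .adLockStatus v b => acquire t s (.status v.1) (.adLockStatus v b) (.adSetAborting v b)
  | .adSetAborting v b => {(s.setStatus v.1 .aborting, .adUnlockStatus v b)}
  | .adUnlockStatus v b => release s (.status v.1) (.adInsert v b)
  | .adInsert v b =>
      {({ s with txnDependency :=
            Function.update s.txnDependency b (insert v.1 (s.txnDependency b)) },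
        .adUnlockDep v b)}
  | .adUnlockDep _ b => release s (.dependency b) (.decrActive .finishedTask)
  -- record
  | .recWrite v R W rest =>
      {q | (rest = ∅ ∧ q = (s, .recLoad v R (W.image Prod.fst))) ∨
        ∃ w ∈ rest, q = (s.setData w.1 v.1 (some (.value v.2 w.2)),
          .recWrite v R W (rest.erase w))}
  | .recLoad v R newLocs =>
      {(s, .recRemove v R newLocs (s.lastWrittenLocations v.1)
        (s.lastWrittenLocations v.1 \ newLocs))}
  | .recRemove v R newLocs prevLocs rest =>
      {q | (rest = ∅ ∧ q = (s, .recStoreLocs v R newLocs prevLocs)) ∨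
        ∃ l ∈ rest, q = (s.setData l v.1 none, .recRemove v R newLocs prevLocs (rest.erase l))}
  | .recStoreLocs v R newLocs prevLocs =>
      {({ s with lastWrittenLocations := Function.update s.lastWrittenLocations v.1 newLocs },
        .recStoreReads v R (decide (newLocs \ prevLocs ≠ ∅)))}
  | .recStoreReads v R w =>
      {({ s with lastReadSet := Function.update s.lastReadSet v.1 R }, .feLockStatus v w)}
  -- finish_execution
  | .feLockStatus v w => acquire t s (.status v.1) (.feLockStatus v w) (.feSetExecuted v w)
  | .feSetExecuted v w => {(s.setStatus v.1 .executed, .feUnlockStatus v w)}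
  | .feUnlockStatus v w => release s (.status v.1) (.feLockDep v w)
  | .feLockDep v w => acquire t s (.dependency v.1) (.feLockDep v w) (.feSwap v w)
  | .feSwap v w =>
      {({ s with txnDependency := Function.update s.txnDependency v.1 ∅ },
        .feUnlockDep v w (s.txnDependency v.1))}
  | .feUnlockDep v w deps => release s (.dependency v.1) (.rdLoop v w deps deps)
  | .feCheckValidationIdx v w =>
      {(s, if (v.1 : ℕ) < s.validationIdx then
            (if w then .feDecrValidationIdx v else dispatch B (some (.validation v)))
          else .decrActive .finishedTask)}
  | .feDecrValidationIdx v =>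
      {({ s with validationIdx := min s.validationIdx v.1 }, .feCountDecr v)}
  | .feCountDecr _ =>
      {({ s with decreaseCnt := s.decreaseCnt + 1 }, .decrActive .finishedTask)}
  -- resume_dependencies
  | .rdLoop v w deps rest =>
      {q | (rest = ∅ ∧ q = (s, if h : deps.Nonempty then .rdDecrExecutionIdx v w (deps.min' h)
              else .feCheckValidationIdx v w)) ∨
        ∃ d ∈ rest, q = (s, .srLock d (.resumeDependencies v w deps (rest.erase d)))}
  | .rdDecrExecutionIdx v w d =>
      {({ s with executionIdx := min s.executionIdx d }, .rdCountDecr v w)}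
  | .rdCountDecr v w =>
      {({ s with decreaseCnt := s.decreaseCnt + 1 }, .feCheckValidationIdx v w)}
  -- set_ready_status
  | .srLock j c => acquire t s (.status j) (.srLock j c) (.srRead j c)
  | .srRead j c => {(s, .srWrite j (s.txnIncarnation j) c)}
  | .srWrite j i c =>
      {({ s with
            txnIncarnation := Function.update s.txnIncarnation j (i + 1)
            txnStatus := Function.update s.txnStatus j .readyToExecute }, .srUnlock j c)}
  | .srUnlock j c => release s (.status j) c.continue
  -- needs_reexecution : validate_read_set
  | .vrLoad v => {(s, .vrLoop v (s.lastReadSet v.1))}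
  | .vrLoop v rest =>
      {q | (rest = ∅ ∧ q = (s, .decrActive .finishedTask)) ∨
        ∃ r ∈ rest, q = (s, if readStillValid r.2 (s.read r.1 v.1) then
          .vrLoop v (rest.erase r) else .vaLock v)}
  -- try_validation_abort
  | .vaLock v => acquire t s (.status v.1) (.vaLock v) (.vaCheck v)
  | .vaCheck v =>
      {(s, if s.txnIncarnation v.1 = v.2 ∧ s.txnStatus v.1 = .executed then .vaSet v
          else .vaUnlock v false)}
  | .vaSet v => {(s.setStatus v.1 .aborting, .vaUnlock v true)}
  | .vaUnlock v r => release s (.status v.1) (if r then .ceLoad v else .decrActive .finishedTask)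
  -- convert_writes_to_estimates
  | .ceLoad v => {(s, .ceLoop v (s.lastWrittenLocations v.1))}
  | .ceLoop v rest =>
      {q | (rest = ∅ ∧ q = (s, .srLock v.1 (.finishValidation v))) ∨
        ∃ l ∈ rest, q = (s.setData l v.1 (some .estimate), .ceLoop v (rest.erase l))}
  -- finish_validation
  | .fvDecrValidationIdx v =>
      {({ s with validationIdx := min s.validationIdx (v.1 + 1) }, .fvCountDecr v)}
  | .fvCountDecr v => {({ s with decreaseCnt := s.decreaseCnt + 1 }, .fvCheckExecutionIdx v)}
  | .fvCheckExecutionIdx v =>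
      {(s, if (v.1 : ℕ) < s.executionIdx then .incLock v.1 .finishedTask
          else .decrActive .finishedTask)}

end Step

/-! ### Runs -/

/-- A global configuration: the shared variables and the program counter of every thread. -/
structure Config (m n : ℕ) (Loc Val σ : Type*) where
  shared : Shared m n Loc Val
  pc : Fin m → PC n Loc Val σ

/-- All threads have just been spawned. -/
def Config.init (m n : ℕ) (Loc Val σ : Type*) : Config m n Loc Val σ where
  shared := Shared.init m n Loc Val
  pc := fun _ => .loop none

/-- The thread is inside an invocation of `VM.execute`. -/
def PC.InVM {n : ℕ} {Loc Val σ : Type*} : PC n Loc Val σ → Prop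
  | .vm _ _ _ _ => True
  | _ => False

section Run

variable {n : ℕ} {Loc Val σ : Type*} [DecidableEq Loc] [DecidableEq Val]

/-- Thread `t` performs one step from `c` to `c'`. -/
def Step {m : ℕ} (B : Block n Loc Val σ) (t : Fin m) (c c' : Config m n Loc Val σ) : Prop :=
  ∃ q ∈ next B t c.shared (c.pc t), c' = ⟨q.1, Function.update c.pc t q.2⟩

/-- A run of `m` threads on a block. At each time at most one thread performs a step (`none` : no
thread does, as is the case at the end of a run that terminates). -/
structure Run (m : ℕ) (B : Block n Loc Val σ) where
  config : ℕ → Config m n Loc Val σ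
  sched : ℕ → Option (Fin m)
  init_eq : config 0 = Config.init m n Loc Val σ
  step_of_some : ∀ T t, sched T = some t → Step B t (config T) (config (T + 1))
  eq_of_none : ∀ T, sched T = none → config (T + 1) = config T

variable {m : ℕ} {B : Block n Loc Val σ}

/-- Thread `t` has joined by time `T`. -/
def Run.JoinedAt (ρ : Run m B) (t : Fin m) (T : ℕ) : Prop := (ρ.config T).pc t = .joined

/-- Every thread keeps taking steps until it joins: a thread that has not joined at time `T` takes
a step at time `T` or later. -/
def Run.KeepsTakingSteps (ρ : Run m B) : Prop :=
  ∀ t T, ¬ ρ.JoinedAt t T → ∃ T' ≥ T, ρ.sched T' = some t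

/-- `VM.execute` is wait-free when `m` threads run the algorithm on the block `B`: in every run,
whatever the other threads do, a thread that keeps taking steps returns from every invocation of
`VM.execute` after finitely many steps of its own. -/
def VMExecuteWaitFree (m : ℕ) (B : Block n Loc Val σ) : Prop :=
  ∀ (ρ : Run m B) (t : Fin m), (∀ T, ∃ T' ≥ T, ρ.sched T' = some t) →
    ∀ T, ∃ T' ≥ T, ¬ ((ρ.config T').pc t).InVM

end Run

end BlockSTM

/-!
Why all threads join.

The *stage* of a transaction `j`, its incarnation number and its status in lexicographic order,
never decreases. This rests on the ownership of transactions (`Config.Invariant`): a transaction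
that is being executed has one owner, the executing thread, and an aborted one is in exactly one
place, with a thread or in a set of dependencies, until it is made ready again. Locks protect the
other changes of a status.

By induction on `j`, the stage of `j` and its entries in the multi-version memory are eventually
constant (`Run.eventually_stage_data_eq`). Suppose that this is so for all transactions below `j`.
An incarnation of `j` that begins from then on records a read set which agrees with the constant
data below `j`, so its validations succeed (`Config.ReadsValid`), and it can only be suspended by
a dependency on a lower transaction. A resumption comes from a lower transaction that becomes
executed, which no longer happens, so the pending resumptions bound the number of further
incarnations (`Move.readies_add_le`, `Run.exists_stage_le`). Within one incarnation the owner
performs finitely many writes (`Move.dataWork_le`).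

When no stage changes any more, a thread decreases the indices boundedly often
(`Move.decreases_le`), and the indices are at most `n + m`, so they become constant as well. From
then on every step of a thread reduces the work left in its task, unless the thread is idle,
blocked by a lock, or in the virtual machine (`Move.work_lt`). In particular `try_execute` does
not restart forever, as the blocking transaction of a read error is not executed
(`Shared.EstimatesBounded`) and its status does not change. The work is well-founded, so after
some time every thread is idle forever, blocked forever, or in the virtual machine forever. The
last is excluded because `VM.execute` is wait-free, and the second because threads that hold the
lock of a status never wait and threads that hold the lock of a set of dependencies wait only for
the lock of a status (`Run.all_idle_of_quiet`). So all threads are idle, the number of active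
tasks is zero, and a thread that has not joined finds both indices to be at least `n`, sets the
done marker, and joins (`Run.exists_joinedAt_of_quiet`).
-/

namespace BlockSTM

section Moves

variable {m n : ℕ} {Loc Val σ : Type*}

/-! ### Transitions -/

/-- The lock that a thread tries to acquire in its next step. -/
def PC.waits : PC n Loc Val σ → Option (Lock n)
  | .nvvLock j | .incLock j _ | .srLock j _ | .adLockBlocking _ j => some (.status j)
  | .adLockStatus v _ | .feLockStatus v _ | .vaLock v => some (.status v.1)
  | .adLockDep _ b => some (.dependency b)
  | .feLockDep v _ => some (.dependency v.1)
  | _ => none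

variable [DecidableEq Loc] [DecidableEq Val]

/-- The transitions of a thread `t`, one constructor for each way in which a step can go. This
relation contains `next` and forgets what the termination argument does not use, such as the code
of the transactions. -/
inductive Move (t : Fin m) (s : Shared m n Loc Val) :
    PC n Loc Val σ → Shared m n Loc Val → PC n Loc Val σ → Prop
  | blocked {p ℓ} (hp : p.waits = some ℓ) (hℓ : s.holder ℓ ≠ none) : Move t s p s p
  | join {task} (h : s.doneMarker = true) : Move t s (.loop task) s .joined
  | askTask (h : s.doneMarker = false) : Move t s (.loop none) s .nextTask
  | execute {v a} : Move t s (.loop (some (.execution v))) s (.vm v a ∅ ∅)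
  | validate {v} : Move t s (.loop (some (.validation v))) s (.vrLoad v)
  | nextTask : Move t s .nextTask s (.nextTaskCompare s.validationIdx)
  | compareLt {i} (h : i < s.executionIdx) : Move t s (.nextTaskCompare i) s .nvvCheck
  | compareGe {i} (h : s.executionIdx ≤ i) : Move t s (.nextTaskCompare i) s .nveCheck
  | nvvCheckDone (h : n ≤ s.validationIdx) : Move t s .nvvCheck s .cdCount
  | nvvCheck (h : s.validationIdx < n) : Move t s .nvvCheck s .nvvIncrActive
  | nvvIncrActive : Move t s .nvvIncrActive { s with numActiveTasks := s.numActiveTasks + 1 }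
      .nvvFetch
  | nvvFetch {j} : Move t s .nvvFetch { s with validationIdx := s.validationIdx + 1 } (.nvvLock j)
  | nvvFetchNone : Move t s .nvvFetch { s with validationIdx := s.validationIdx + 1 }
      (.decrActive .nextTask)
  | nvvLock {j} (h : s.holder (.status j) = none) :
      Move t s (.nvvLock j) (s.setHolder (.status j) (some t)) (.nvvRead j)
  | nvvRead {j} (h : s.txnStatus j = .executed) :
      Move t s (.nvvRead j) s (.nvvUnlock j (some (j, s.txnIncarnation j)))
  | nvvReadNone {j} : Move t s (.nvvRead j) s (.nvvUnlock j none)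
  | nvvUnlock {j v} : Move t s (.nvvUnlock j (some v)) (s.setHolder (.status j) none)
      (.loop (some (.validation v)))
  | nvvUnlockNone {j} : Move t s (.nvvUnlock j none) (s.setHolder (.status j) none)
      (.decrActive .nextTask)
  | nveCheckDone (h : n ≤ s.executionIdx) : Move t s .nveCheck s .cdCount
  | nveCheck (h : s.executionIdx < n) : Move t s .nveCheck s .nveIncrActive
  | nveIncrActive : Move t s .nveIncrActive { s with numActiveTasks := s.numActiveTasks + 1 }
      .nveFetch
  | nveFetch {j} : Move t s .nveFetch { s with executionIdx := s.executionIdx + 1 }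
      (.incLock j .nextTask)
  | nveFetchNone : Move t s .nveFetch { s with executionIdx := s.executionIdx + 1 }
      (.decrActive .nextTask)
  | incLock {j o} (h : s.holder (.status j) = none) :
      Move t s (.incLock j o) (s.setHolder (.status j) (some t)) (.incCheck j o)
  | incCheck {j o} (h : s.txnStatus j = .readyToExecute) : Move t s (.incCheck j o) s (.incSet j o)
  | incCheckNone {j o} : Move t s (.incCheck j o) s (.incUnlock j o none)
  | incSet {j o} : Move t s (.incSet j o) (s.setStatus j .executing) (.incGet j o)
  | incGet {j o} : Move t s (.incGet j o) s (.incUnlock j o (some (j, s.txnIncarnation j)))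
  | incUnlock {j o v} : Move t s (.incUnlock j o (some v)) (s.setHolder (.status j) none)
      (.loop (some (.execution v)))
  | incUnlockNone {j o} : Move t s (.incUnlock j o none) (s.setHolder (.status j) none)
      (.decrActive o)
  | decrNext : Move t s (.decrActive .nextTask) { s with numActiveTasks := s.numActiveTasks - 1 }
      (.loop none)
  | decrFinished : Move t s (.decrActive .finishedTask)
      { s with numActiveTasks := s.numActiveTasks - 1 } .nextTask
  | cdCount : Move t s .cdCount s (.cdExecutionIdx s.decreaseCnt)
  | cdExecutionIdx {c} (h : n ≤ s.executionIdx) :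
      Move t s (.cdExecutionIdx c) s (.cdValidationIdx c)
  | cdExecutionIdxFail {c} (h : s.executionIdx < n) : Move t s (.cdExecutionIdx c) s (.loop none)
  | cdValidationIdx {c} (h : n ≤ s.validationIdx) : Move t s (.cdValidationIdx c) s (.cdActive c)
  | cdValidationIdxFail {c} (h : s.validationIdx < n) :
      Move t s (.cdValidationIdx c) s (.loop none)
  | cdActive {c} (h : s.numActiveTasks = 0) : Move t s (.cdActive c) s (.cdRecount c)
  | cdActiveFail {c} (h : s.numActiveTasks ≠ 0) : Move t s (.cdActive c) s (.loop none)
  | cdRecount {c} (h : c = s.decreaseCnt) : Move t s (.cdRecount c) s .cdSet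
  | cdRecountFail {c} (h : c ≠ s.decreaseCnt) : Move t s (.cdRecount c) s (.loop none)
  | cdSet : Move t s .cdSet { s with doneMarker := true } (.loop none)
  | vmHalt {v a R W} : Move t s (.vm v a R W) s (.recWrite v R W W)
  | vmLocal {v a R W a' W'} : Move t s (.vm v a R W) s (.vm v a' R W')
  | vmNotFound {v a R W l a'} (h : s.read l v.1 = .notFound) :
      Move t s (.vm v a R W) s (.vm v a' (insert (l, none) R) W)
  | vmOk {v a R W l u x a'} (h : s.read l v.1 = .ok u x) :
      Move t s (.vm v a R W) s (.vm v a' (insert (l, some u) R) W)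
  | vmReadError {v a R W l b} (h : s.read l v.1 = .readError b) :
      Move t s (.vm v a R W) s (.adLockDep v b)
  | adLockDep {v b} (h : s.holder (.dependency b) = none) :
      Move t s (.adLockDep v b) (s.setHolder (.dependency b) (some t)) (.adLockBlocking v b)
  | adLockBlocking {v b} (h : s.holder (.status b) = none) :
      Move t s (.adLockBlocking v b) (s.setHolder (.status b) (some t)) (.adReadBlocking v b)
  | adReadResolved {v b} (h : s.txnStatus b = .executed) :
      Move t s (.adReadBlocking v b) s (.adUnlockBlocking v b true)
  | adReadBlocking {v b} (h : s.txnStatus b ≠ .executed) :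
      Move t s (.adReadBlocking v b) s (.adUnlockBlocking v b false)
  | adUnlockResolved {v b} : Move t s (.adUnlockBlocking v b true) (s.setHolder (.status b) none)
      (.adUnlockRetry v b)
  | adUnlockBlocking {v b} : Move t s (.adUnlockBlocking v b false)
      (s.setHolder (.status b) none) (.adLockStatus v b)
  | adUnlockRetry {v b a} : Move t s (.adUnlockRetry v b) (s.setHolder (.dependency b) none)
      (.vm v a ∅ ∅)
  | adLockStatus {v b} (h : s.holder (.status v.1) = none) :
      Move t s (.adLockStatus v b) (s.setHolder (.status v.1) (some t)) (.adSetAborting v b)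
  | adSetAborting {v b} : Move t s (.adSetAborting v b) (s.setStatus v.1 .aborting)
      (.adUnlockStatus v b)
  | adUnlockStatus {v b} : Move t s (.adUnlockStatus v b) (s.setHolder (.status v.1) none)
      (.adInsert v b)
  | adInsert {v b} : Move t s (.adInsert v b)
      { s with txnDependency :=
          Function.update s.txnDependency b (insert v.1 (s.txnDependency b)) } (.adUnlockDep v b)
  | adUnlockDep {v b} : Move t s (.adUnlockDep v b) (s.setHolder (.dependency b) none)
      (.decrActive .finishedTask)
  | recWriteEnd {v R W} : Move t s (.recWrite v R W ∅) s (.recLoad v R (W.image Prod.fst))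
  | recWrite {v R W rest w} (h : w ∈ rest) : Move t s (.recWrite v R W rest)
      (s.setData w.1 v.1 (some (.value v.2 w.2))) (.recWrite v R W (rest.erase w))
  | recLoad {v R L} : Move t s (.recLoad v R L) s
      (.recRemove v R L (s.lastWrittenLocations v.1) (s.lastWrittenLocations v.1 \ L))
  | recRemoveEnd {v R L P} : Move t s (.recRemove v R L P ∅) s (.recStoreLocs v R L P)
  | recRemove {v R L P rest l} (h : l ∈ rest) : Move t s (.recRemove v R L P rest)
      (s.setData l v.1 none) (.recRemove v R L P (rest.erase l))
  | recStoreLocs {v R L P w} : Move t s (.recStoreLocs v R L P)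
      { s with lastWrittenLocations := Function.update s.lastWrittenLocations v.1 L }
      (.recStoreReads v R w)
  | recStoreReads {v R w} : Move t s (.recStoreReads v R w)
      { s with lastReadSet := Function.update s.lastReadSet v.1 R } (.feLockStatus v w)
  | feLockStatus {v w} (h : s.holder (.status v.1) = none) :
      Move t s (.feLockStatus v w) (s.setHolder (.status v.1) (some t)) (.feSetExecuted v w)
  | feSetExecuted {v w} : Move t s (.feSetExecuted v w) (s.setStatus v.1 .executed)
      (.feUnlockStatus v w)
  | feUnlockStatus {v w} : Move t s (.feUnlockStatus v w) (s.setHolder (.status v.1) none)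
      (.feLockDep v w)
  | feLockDep {v w} (h : s.holder (.dependency v.1) = none) :
      Move t s (.feLockDep v w) (s.setHolder (.dependency v.1) (some t)) (.feSwap v w)
  | feSwap {v w} : Move t s (.feSwap v w)
      { s with txnDependency := Function.update s.txnDependency v.1 ∅ }
      (.feUnlockDep v w (s.txnDependency v.1))
  | feUnlockDep {v w deps} : Move t s (.feUnlockDep v w deps)
      (s.setHolder (.dependency v.1) none) (.rdLoop v w deps deps)
  | feCheckValidate {v w} : Move t s (.feCheckValidationIdx v w) s (.vrLoad v)
  | feCheckDecrease {v w} : Move t s (.feCheckValidationIdx v w) s (.feDecrValidationIdx v)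
  | feCheckNone {v w} : Move t s (.feCheckValidationIdx v w) s (.decrActive .finishedTask)
  | feDecrValidationIdx {v} : Move t s (.feDecrValidationIdx v)
      { s with validationIdx := min s.validationIdx v.1 } (.feCountDecr v)
  | feCountDecr {v} : Move t s (.feCountDecr v) { s with decreaseCnt := s.decreaseCnt + 1 }
      (.decrActive .finishedTask)
  | rdLoopDecrease {v w deps d} : Move t s (.rdLoop v w deps ∅) s (.rdDecrExecutionIdx v w d)
  | rdLoopEnd {v w deps} : Move t s (.rdLoop v w deps ∅) s (.feCheckValidationIdx v w)
  | rdLoop {v w deps rest d} (h : d ∈ rest) : Move t s (.rdLoop v w deps rest) s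
      (.srLock d (.resumeDependencies v w deps (rest.erase d)))
  | rdDecrExecutionIdx {v w d} : Move t s (.rdDecrExecutionIdx v w d)
      { s with executionIdx := min s.executionIdx (d : Fin n) } (.rdCountDecr v w)
  | rdCountDecr {v w} : Move t s (.rdCountDecr v w) { s with decreaseCnt := s.decreaseCnt + 1 }
      (.feCheckValidationIdx v w)
  | srLock {j c} (h : s.holder (.status j) = none) :
      Move t s (.srLock j c) (s.setHolder (.status j) (some t)) (.srRead j c)
  | srRead {j c} : Move t s (.srRead j c) s (.srWrite j (s.txnIncarnation j) c)
  | srWrite {j i c} : Move t s (.srWrite j i c)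
      { s with
        txnIncarnation := Function.update s.txnIncarnation j (i + 1)
        txnStatus := Function.update s.txnStatus j .readyToExecute } (.srUnlock j c)
  | srUnlockResume {j v w deps rest} : Move t s (.srUnlock j (.resumeDependencies v w deps rest))
      (s.setHolder (.status j) none) (.rdLoop v w deps rest)
  | srUnlockAbort {j v} : Move t s (.srUnlock j (.finishValidation v))
      (s.setHolder (.status j) none) (.fvDecrValidationIdx v)
  | vrLoad {v} : Move t s (.vrLoad v) s (.vrLoop v (s.lastReadSet v.1))
  | vrLoopEnd {v} : Move t s (.vrLoop v ∅) s (.decrActive .finishedTask)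
  | vrLoop {v rest r} (h : r ∈ rest) : Move t s (.vrLoop v rest) s (.vrLoop v (rest.erase r))
  | vrFail {v rest r} (h : r ∈ rest) (hr : ¬ readStillValid r.2 (s.read r.1 v.1)) :
      Move t s (.vrLoop v rest) s (.vaLock v)
  | vaLock {v} (h : s.holder (.status v.1) = none) :
      Move t s (.vaLock v) (s.setHolder (.status v.1) (some t)) (.vaCheck v)
  | vaCheck {v} (h : s.txnIncarnation v.1 = v.2 ∧ s.txnStatus v.1 = .executed) :
      Move t s (.vaCheck v) s (.vaSet v)
  | vaCheckFail {v} : Move t s (.vaCheck v) s (.vaUnlock v false)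
  | vaSet {v} : Move t s (.vaSet v) (s.setStatus v.1 .aborting) (.vaUnlock v true)
  | vaUnlockAborted {v} : Move t s (.vaUnlock v true) (s.setHolder (.status v.1) none) (.ceLoad v)
  | vaUnlock {v} : Move t s (.vaUnlock v false) (s.setHolder (.status v.1) none)
      (.decrActive .finishedTask)
  | ceLoad {v} : Move t s (.ceLoad v) s (.ceLoop v (s.lastWrittenLocations v.1))
  | ceLoopEnd {v} : Move t s (.ceLoop v ∅) s (.srLock v.1 (.finishValidation v))
  | ceLoop {v rest l} (h : l ∈ rest) : Move t s (.ceLoop v rest)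
      (s.setData l v.1 (some .estimate)) (.ceLoop v (rest.erase l))
  | fvDecrValidationIdx {v} : Move t s (.fvDecrValidationIdx v)
      { s with validationIdx := min s.validationIdx (v.1 + 1) } (.fvCountDecr v)
  | fvCountDecr {v} : Move t s (.fvCountDecr v) { s with decreaseCnt := s.decreaseCnt + 1 }
      (.fvCheckExecutionIdx v)
  | fvCheck {v} : Move t s (.fvCheckExecutionIdx v) s (.incLock v.1 .finishedTask)
  | fvCheckNone {v} : Move t s (.fvCheckExecutionIdx v) s (.decrActive .finishedTask)

theorem Move.of_acquire {t : Fin m} {s s' : Shared m n Loc Val} {ℓ : Lock n}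
    {p p' q : PC n Loc Val σ} (h : (s', p') ∈ acquire t s ℓ p q) (hp : p.waits = some ℓ)
    (hq : s.holder ℓ = none → Move t s p (s.setHolder ℓ (some t)) q) : Move t s p s' p' := by
  unfold acquire at h
  split at h
  · next hℓ =>
    obtain ⟨rfl, rfl⟩ := Prod.mk.inj h
    exact hq hℓ
  · next x hℓ =>
    obtain ⟨rfl, rfl⟩ := Prod.mk.inj h
    exact .blocked hp (by simp [hℓ])

theorem Move.of_next {B : Block n Loc Val σ} {t : Fin m} {s s' : Shared m n Loc Val}
    {p p' : PC n Loc Val σ} (h : (s', p') ∈ next B t s p) : Move t s p s' p' := by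
  cases p
  case nvvLock | incLock | adLockDep | adLockBlocking | adLockStatus | feLockStatus | feLockDep |
      srLock | vaLock =>
    refine Move.of_acquire h rfl fun hℓ => ?_
    constructor
    assumption
  case loop task =>
    rcases task with _ | (v | v) <;> simp only [next, Set.mem_singleton_iff, Prod.mk.injEq] at h <;>
      obtain ⟨rfl, rfl⟩ := h <;> split_ifs with hd <;> constructor <;> simp_all
  case nvvUnlock j o =>
    cases o <;> simp only [next, release, Set.mem_singleton_iff, Prod.mk.injEq] at h <;>
      obtain ⟨rfl, rfl⟩ := h <;> constructor
  case incUnlock j _ o =>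
    cases o <;> simp only [next, release, Set.mem_singleton_iff, Prod.mk.injEq] at h <;>
      obtain ⟨rfl, rfl⟩ := h <;> constructor
  case decrActive o =>
    cases o <;> simp only [next, Set.mem_singleton_iff, Prod.mk.injEq] at h <;>
      obtain ⟨rfl, rfl⟩ := h <;> constructor
  case srUnlock j c =>
    cases c <;> simp only [next, release, Set.mem_singleton_iff, Prod.mk.injEq] at h <;>
      obtain ⟨rfl, rfl⟩ := h <;> constructor
  case nvvFetch =>
    simp only [next, Set.mem_singleton_iff, Prod.mk.injEq, tryValidateFetched] at h
    obtain ⟨rfl, rfl⟩ := h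
    split_ifs <;> constructor
  case nveFetch =>
    simp only [next, Set.mem_singleton_iff, Prod.mk.injEq, tryIncarnateFetched] at h
    obtain ⟨rfl, rfl⟩ := h
    split_ifs <;> constructor
  case vm v a R W =>
    simp only [next] at h
    split at h
    · obtain ⟨rfl, rfl⟩ := Prod.mk.inj h
      exact .vmHalt
    · obtain ⟨rfl, rfl⟩ := Prod.mk.inj h
      exact .vmLocal
    · obtain ⟨rfl, rfl⟩ := Prod.mk.inj h
      exact .vmLocal
    · rcases h with ⟨x, -, h⟩ | ⟨-, h⟩
      · obtain ⟨rfl, rfl⟩ := Prod.mk.inj h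
        exact .vmLocal
      · split at h <;> obtain ⟨rfl, rfl⟩ := Prod.mk.inj h
        · exact .vmNotFound ‹_›
        · exact .vmOk ‹_›
        · exact .vmReadError ‹_›
  case recWrite v R W rest =>
    rcases h with ⟨rfl, h⟩ | ⟨w, hw, h⟩ <;> obtain ⟨rfl, rfl⟩ := Prod.mk.inj h
    · exact .recWriteEnd
    · exact .recWrite hw
  case recRemove v R L P rest =>
    rcases h with ⟨rfl, h⟩ | ⟨w, hw, h⟩ <;> obtain ⟨rfl, rfl⟩ := Prod.mk.inj h
    · exact .recRemoveEnd
    · exact .recRemove hw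
  case rdLoop v w deps rest =>
    rcases h with ⟨rfl, h⟩ | ⟨d, hd, h⟩ <;> obtain ⟨rfl, rfl⟩ := Prod.mk.inj h
    · split_ifs
      · exact .rdLoopDecrease
      · exact .rdLoopEnd
    · exact .rdLoop hd
  case vrLoop v rest =>
    rcases h with ⟨rfl, h⟩ | ⟨r, hr, h⟩ <;> obtain ⟨rfl, rfl⟩ := Prod.mk.inj h
    · exact .vrLoopEnd
    · split_ifs with hv
      · exact .vrLoop hr
      · exact .vrFail hr hv
  case ceLoop v rest =>
    rcases h with ⟨rfl, h⟩ | ⟨l, hl, h⟩ <;> obtain ⟨rfl, rfl⟩ := Prod.mk.inj h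
    · exact .ceLoopEnd
    · exact .ceLoop hl
  case joined => exact absurd h (Set.notMem_empty _)
  case adUnlockBlocking v b r =>
    cases r <;> simp only [next, release, Set.mem_singleton_iff, Prod.mk.injEq] at h <;>
      obtain ⟨rfl, rfl⟩ := h <;> constructor
  case vaUnlock v r =>
    cases r <;> simp only [next, release, Set.mem_singleton_iff, Prod.mk.injEq] at h <;>
      obtain ⟨rfl, rfl⟩ := h <;> constructor
  case feCheckValidationIdx v w =>
    simp only [next, Set.mem_singleton_iff, Prod.mk.injEq] at h
    obtain ⟨rfl, rfl⟩ := h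
    split_ifs <;> constructor
  case adReadBlocking v b =>
    simp only [next, Set.mem_singleton_iff, Prod.mk.injEq] at h
    obtain ⟨rfl, rfl⟩ := h
    by_cases hb : s'.txnStatus b = .executed <;> simp only [hb, decide_true, decide_false]
    · exact .adReadResolved hb
    · exact .adReadBlocking hb
  all_goals
    simp only [next, release, Set.mem_singleton_iff, Prod.mk.injEq] at h
    obtain ⟨rfl, rfl⟩ := h
    (try split_ifs) <;> constructor <;> first | assumption | (push Not at *; assumption)

end Moves

section StepLemmas

variable {m n : ℕ} {Loc Val σ : Type*}

attribute [local simp] Shared.setHolder Shared.setStatus Shared.setData Function.update_apply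

/-! ### Locks -/

/-- The locks that a thread holds. -/
def PC.Holds : PC n Loc Val σ → Lock n → Prop
  | .nvvRead j, ℓ | .nvvUnlock j _, ℓ | .incCheck j _, ℓ | .incSet j _, ℓ | .incGet j _, ℓ
  | .incUnlock j _ _, ℓ | .srRead j _, ℓ | .srWrite j _ _, ℓ | .srUnlock j _, ℓ => ℓ = .status j
  | .vaCheck v, ℓ | .vaSet v, ℓ | .vaUnlock v _, ℓ | .feSetExecuted v _, ℓ
  | .feUnlockStatus v _, ℓ => ℓ = .status v.1
  | .adReadBlocking _ b, ℓ | .adUnlockBlocking _ b _, ℓ => ℓ = .dependency b ∨ ℓ = .status b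
  | .adSetAborting v b, ℓ | .adUnlockStatus v b, ℓ => ℓ = .dependency b ∨ ℓ = .status v.1
  | .adLockBlocking _ b, ℓ | .adUnlockRetry _ b, ℓ | .adLockStatus _ b, ℓ | .adInsert _ b, ℓ
  | .adUnlockDep _ b, ℓ => ℓ = .dependency b
  | .feSwap v _, ℓ | .feUnlockDep v _ _, ℓ => ℓ = .dependency v.1
  | _, _ => False

variable [DecidableEq Loc] [DecidableEq Val]
variable {t : Fin m} {s s' : Shared m n Loc Val} {p p' : PC n Loc Val σ}

theorem Move.holder_self (h : Move t s p s' p') (hp : ∀ ℓ, s.holder ℓ = some t ↔ p.Holds ℓ)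
    (ℓ : Lock n) : s'.holder ℓ = some t ↔ p'.Holds ℓ := by
  have := hp ℓ
  cases h <;> simp_all [PC.Holds] <;> grind

theorem Move.holder_other (h : Move t s p s' p') (hp : ∀ ℓ, s.holder ℓ = some t ↔ p.Holds ℓ)
    {u : Fin m} (hu : u ≠ t) (ℓ : Lock n) : s'.holder ℓ = some u ↔ s.holder ℓ = some u := by
  have := hp ℓ
  cases h <;> simp_all [PC.Holds] <;> grind

theorem Move.holds_status_of_ne (h : Move t s p s' p') {j : Fin n}
    (hj : s'.txnStatus j ≠ s.txnStatus j ∨ s'.txnIncarnation j ≠ s.txnIncarnation j) :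
    p.Holds (.status j) := by
  cases h <;> simp_all [PC.Holds]
  all_goals grind

/-! ### Ownership of transactions -/

/-- The transaction which a thread is executing. -/
def PC.executes : PC n Loc Val σ → Option (Fin n)
  | .incGet j _ => some j
  | .incUnlock _ _ (some v) | .loop (some (.execution v)) | .vm v _ _ _ | .adLockDep v _
  | .adLockBlocking v _ | .adReadBlocking v _ | .adUnlockBlocking v _ _ | .adUnlockRetry v _
  | .adLockStatus v _ | .adSetAborting v _ | .recWrite v _ _ _ | .recLoad v _ _
  | .recRemove v _ _ _ _ | .recStoreLocs v _ _ _ | .recStoreReads v _ _ | .feLockStatus v _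
  | .feSetExecuted v _ => some v.1
  | _ => none

/-- The number of calls of `set_ready_status` for `j` which the caller will still make. -/
def ReadyCaller.readies : ReadyCaller n → Fin n → ℕ
  | .resumeDependencies _ _ _ rest, j => if j ∈ rest then 1 else 0
  | .finishValidation _, _ => 0

/-- The number of times that a thread will set the status of `j` to ready before it has completed
its current task, by resuming `j` or after aborting it. -/
def PC.readies : PC n Loc Val σ → Fin n → ℕ
  | .vaUnlock v true, j | .ceLoad v, j | .ceLoop v _, j => if v.1 = j then 1 else 0
  | .srLock d c, j | .srRead d c, j | .srWrite d _ c, j => (if d = j then 1 else 0) + c.readies j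
  | .srUnlock _ c, j => c.readies j
  | .rdLoop _ _ _ rest, j => if j ∈ rest then 1 else 0
  | .feUnlockDep _ _ deps, j => if j ∈ deps then 1 else 0
  | _, _ => 0

/-- The transaction which a thread has set to aborting and is about to insert into a set of
dependencies. -/
def PC.suspends : PC n Loc Val σ → Option (Fin n)
  | .adUnlockStatus v _ | .adInsert v _ => some v.1
  | _ => none

/-- Facts about the status of a transaction which a thread has checked or read while it holds the
lock of that status. -/
def PC.CheckedStatus (s : Shared m n Loc Val) : PC n Loc Val σ → Prop
  | .incSet j _ => s.txnStatus j = .readyToExecute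
  | .srWrite j i _ => i = s.txnIncarnation j
  | .vaSet v => s.txnIncarnation v.1 = v.2 ∧ s.txnStatus v.1 = .executed
  | _ => True

theorem Move.checkedStatus_self (h : Move t s p s' p') (hp : p.CheckedStatus s) :
    p'.CheckedStatus s' := by
  cases h <;> simp_all [PC.CheckedStatus]

omit [DecidableEq Loc] [DecidableEq Val] in
theorem PC.CheckedStatus.congr (hp : p.CheckedStatus s)
    (h : ∀ j, p.Holds (.status j) →
      s'.txnStatus j = s.txnStatus j ∧ s'.txnIncarnation j = s.txnIncarnation j) :
    p.CheckedStatus s' := by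
  cases p <;> simp_all [PC.CheckedStatus, PC.Holds]

/-- The number of executions of `j` that a thread is performing. -/
def PC.executions (p : PC n Loc Val σ) (j : Fin n) : ℕ := if p.executes = some j then 1 else 0

/-- The number of tokens for `j`, as an aborted transaction, in the hands of a thread. -/
def PC.aborts (p : PC n Loc Val σ) (j : Fin n) : ℕ :=
  p.readies j + if p.suspends = some j then 1 else 0

/-- The number of sets of dependencies to which `j` belongs. -/
def Shared.dependencies (s : Shared m n Loc Val) (j : Fin n) : ℕ :=
  (Finset.univ.filter fun b => j ∈ s.txnDependency b).card

theorem Move.executions_add_le (h : Move t s p s' p') (hc : p.CheckedStatus s) (j : Fin n)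
    (he : p.executions j ≤ if s.txnStatus j = .executing then 1 else 0)
    (ha : p.aborts j ≤ if s.txnStatus j = .aborting then 1 else 0) :
    p'.executions j + (if s.txnStatus j = .executing then 1 else 0) ≤
      p.executions j + if s'.txnStatus j = .executing then 1 else 0 := by
  cases h <;> simp_all [PC.CheckedStatus, PC.executions, PC.aborts, PC.executes, PC.readies,
    PC.suspends] <;> grind

theorem Move.txnDependency_eq (h : Move t s p s' p') (hi : ∀ v b, p ≠ .adInsert v b)
    (hs : ∀ v w, p ≠ .feSwap v w) : s'.txnDependency = s.txnDependency := by
  cases h <;> simp_all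

theorem Move.aborts_add_le (h : Move t s p s' p') (hc : p.CheckedStatus s) (j : Fin n)
    (he : p.executions j ≤ if s.txnStatus j = .executing then 1 else 0)
    (ha : p.aborts j + s.dependencies j ≤ if s.txnStatus j = .aborting then 1 else 0) :
    p'.aborts j + s'.dependencies j + (if s.txnStatus j = .aborting then 1 else 0) ≤
      p.aborts j + s.dependencies j + if s'.txnStatus j = .aborting then 1 else 0 := by
  by_cases hi : ∃ v b, p = .adInsert v b
  · obtain ⟨v, b, rfl⟩ := hi
    cases h with
    | blocked hp => simp [PC.waits] at hp
    | adInsert =>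
      have hd : Shared.dependencies { s with
          txnDependency := Function.update s.txnDependency b
            (insert v.1 (s.txnDependency b)) } j ≤
          s.dependencies j + if v.1 = j then 1 else 0 := by
        unfold Shared.dependencies
        split_ifs with hv
        · refine (Finset.card_le_card (t := insert b
            (Finset.univ.filter fun b => j ∈ s.txnDependency b)) fun c hc => ?_).trans
              (Finset.card_insert_le _ _)
          by_cases hcb : c = b <;> simp_all
        · rw [Nat.add_zero]
          refine Finset.card_le_card fun c hc => ?_
          by_cases hcb : c = b <;> simp_all [eq_comm]
      simp [PC.aborts, PC.readies, PC.suspends] at hd ⊢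
      omega
  by_cases hs : ∃ v w, p = .feSwap v w
  · obtain ⟨v, w, rfl⟩ := hs
    cases h with
    | blocked hp => simp [PC.waits] at hp
    | feSwap =>
      have hd : Shared.dependencies { s with
          txnDependency := Function.update s.txnDependency v.1 ∅ } j +
            (if j ∈ s.txnDependency v.1 then 1 else 0) ≤
          s.dependencies j := by
        unfold Shared.dependencies
        split_ifs with hv
        · refine (Finset.card_lt_card ((Finset.ssubset_iff_of_subset fun c hc => ?_).2
            ⟨v.1, by simpa using hv, by simp⟩))
          by_cases hcb : c = v.1 <;> simp_all
        · rw [Nat.add_zero]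
          refine Finset.card_le_card fun c hc => ?_
          by_cases hcb : c = v.1 <;> simp_all
      simp [PC.aborts, PC.readies, PC.suspends] at hd ⊢
      omega
  have hd : s'.dependencies j = s.dependencies j := by
    unfold Shared.dependencies
    rw [h.txnDependency_eq (by grind) (by grind)]
  rw [hd]
  cases h <;> simp_all [PC.CheckedStatus, PC.executions, PC.aborts, PC.executes, PC.readies,
    PC.suspends, ReadyCaller.readies] <;> grind

/-! ### The stage of a transaction -/

/-- The order in which one incarnation passes through the statuses. -/
def Status.rank : Status → ℕ
  | .readyToExecute => 0
  | .executing => 1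
  | .executed => 2
  | .aborting => 3

/-- The incarnation number and the status of transaction `j`, in lexicographic order. -/
def Shared.stage (s : Shared m n Loc Val) (j : Fin n) : ℕ :=
  4 * s.txnIncarnation j + (s.txnStatus j).rank

theorem Status.rank_le (a : Status) : a.rank ≤ 3 := by cases a <;> simp [rank]

theorem Status.rank_injective : Function.Injective Status.rank := by
  intro a b h
  cases a <;> cases b <;> simp_all [rank]

omit [DecidableEq Loc] [DecidableEq Val] in
theorem Shared.stage_eq_iff {j : Fin n} : s'.stage j = s.stage j ↔
    s'.txnStatus j = s.txnStatus j ∧ s'.txnIncarnation j = s.txnIncarnation j := by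
  have h := (s.txnStatus j).rank_le
  have h' := (s'.txnStatus j).rank_le
  constructor
  · intro e
    unfold stage at e
    exact ⟨Status.rank_injective (by omega), by omega⟩
  · rintro ⟨e, e'⟩
    simp [stage, e, e']

omit [DecidableEq Loc] [DecidableEq Val] in
theorem Shared.txnIncarnation_le_of_stage_le {j : Fin n} (h : s.stage j ≤ s'.stage j) :
    s.txnIncarnation j ≤ s'.txnIncarnation j := by
  have h := (s.txnStatus j).rank_le
  have h' := (s'.txnStatus j).rank_le
  unfold stage at *
  omega

theorem Move.stage_le (h : Move t s p s' p') (hc : p.CheckedStatus s) (j : Fin n)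
    (he : p.executions j ≤ if s.txnStatus j = .executing then 1 else 0) :
    s.stage j ≤ s'.stage j := by
  have := (s.txnStatus j).rank_le
  cases h <;> simp_all [PC.CheckedStatus, PC.executions, PC.executes, Shared.stage] <;>
    grind [Status.rank]

/-! ### Versions -/

/-- The bounds on the versions and on the blocking transaction in the hands of a thread: the
incarnation has begun, and it has been executed if it is to be validated. -/
def PC.VersionsBounded (s : Shared m n Loc Val) : PC n Loc Val σ → Prop
  | .incUnlock _ _ (some v) | .loop (some (.execution v)) | .vm v _ _ _ | .recWrite v _ _ _
  | .recLoad v _ _ | .recRemove v _ _ _ _ | .recStoreLocs v _ _ _ | .recStoreReads v _ _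
  | .feLockStatus v _ | .feSetExecuted v _ => v.2 ≤ s.txnIncarnation v.1
  | .adLockDep v b | .adLockBlocking v b | .adReadBlocking v b | .adUnlockBlocking v b _
  | .adUnlockRetry v b | .adLockStatus v b | .adSetAborting v b =>
      v.2 ≤ s.txnIncarnation v.1 ∧ b < v.1
  | .adUnlockStatus v b | .adInsert v b => b < v.1
  | .feUnlockStatus v _ | .feLockDep v _ | .feSwap v _ | .feUnlockDep v _ _ | .rdLoop v _ _ _
  | .rdDecrExecutionIdx v _ _ | .rdCountDecr v _ | .feCheckValidationIdx v _
  | .srLock _ (.resumeDependencies v _ _ _) | .srRead _ (.resumeDependencies v _ _ _)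
  | .srWrite _ _ (.resumeDependencies v _ _ _) | .srUnlock _ (.resumeDependencies v _ _ _)
  | .nvvUnlock _ (some v) | .loop (some (.validation v)) | .vrLoad v | .vrLoop v _ | .vaLock v
  | .vaCheck v => 4 * v.2 + 2 ≤ s.stage v.1
  | _ => True

omit [DecidableEq Loc] [DecidableEq Val] in
theorem PC.VersionsBounded.mono (hp : p.VersionsBounded s)
    (h : ∀ j, s.stage j ≤ s'.stage j) : p.VersionsBounded s' := by
  have h' := fun j => Shared.txnIncarnation_le_of_stage_le (h j)
  unfold PC.VersionsBounded at *
  split at hp <;> simp_all <;> grind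

omit [DecidableEq Loc] [DecidableEq Val] in
theorem Shared.of_read_eq_readError {l : Loc} {j b : Fin n} (h : s.read l j = .readError b) :
    b < j ∧ s.data l b = some .estimate := by
  unfold Shared.read at h
  simp only at h
  split_ifs at h with hS
  have := Finset.max'_mem _ hS
  split at h
  · cases h
  · cases h
    simp_all
  · cases h

theorem Move.versionsBounded (h : Move t s p s' p') (hp : p.VersionsBounded s)
    (hs : ∀ j, s.stage j ≤ s'.stage j) : p'.VersionsBounded s' := by
  have hp' := hp.mono hs
  cases h
  case vmReadError h =>
    have := Shared.of_read_eq_readError h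
    simp_all [PC.VersionsBounded]
  case srLock j c h => cases c <;> simp_all [PC.VersionsBounded]
  case srRead j c => cases c <;> simp_all [PC.VersionsBounded]
  case srWrite j c => cases c <;> simp_all [PC.VersionsBounded]
  all_goals simp_all [PC.VersionsBounded, Shared.stage, Status.rank]

/-! ### Estimates -/

/-- The progress of a thread in replacing the estimates of the transaction that it executes, and
the locations of the estimates that it writes. -/
def PC.EstimatesTracked (s : Shared m n Loc Val) : PC n Loc Val σ → Prop
  | .recWrite v _ W rest =>
      ∀ x ∈ W, s.data x.1 v.1 = some .estimate → ∃ y ∈ rest, y.1 = x.1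
  | .recLoad v _ L => ∀ l ∈ L, s.data l v.1 ≠ some .estimate
  | .recRemove v _ _ _ rest => ∀ l, s.data l v.1 = some .estimate → l ∈ rest
  | .recStoreLocs v _ _ _ | .recStoreReads v _ _ | .feLockStatus v _ | .feSetExecuted v _ =>
      ∀ l, s.data l v.1 ≠ some .estimate
  | .ceLoop v rest => rest ⊆ s.lastWrittenLocations v.1
  | _ => True

/-- Only a transaction which is not executed has estimates, at locations that it has written. -/
def Shared.EstimatesBounded (s : Shared m n Loc Val) : Prop :=
  ∀ l b, s.data l b = some .estimate →
    s.txnStatus b ≠ .executed ∧ l ∈ s.lastWrittenLocations b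

theorem Move.estimatesTracked (h : Move t s p s' p') (hp : p.EstimatesTracked s)
    (hs : s.EstimatesBounded) : p'.EstimatesTracked s' := by
  unfold Shared.EstimatesBounded at hs
  cases h <;> simp_all [PC.EstimatesTracked] <;> grind

theorem Move.estimatesBounded (h : Move t s p s' p') (hp : p.EstimatesTracked s)
    (ha : ∀ j, p.aborts j ≤ if s.txnStatus j = .aborting then 1 else 0)
    (hs : s.EstimatesBounded) : s'.EstimatesBounded := by
  unfold Shared.EstimatesBounded at *
  cases h <;> simp_all [PC.EstimatesTracked, PC.aborts, PC.readies, PC.suspends] <;> grind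

omit [DecidableEq Loc] [DecidableEq Val] in
theorem PC.EstimatesTracked.congr (hp : p.EstimatesTracked s)
    (h : ∀ j, p.executes = some j ∨ 0 < p.readies j → (∀ l, s'.data l j = s.data l j) ∧
      s'.lastWrittenLocations j = s.lastWrittenLocations j) : p.EstimatesTracked s' := by
  cases p <;> simp_all [PC.EstimatesTracked, PC.executes, PC.readies]
  assumption

theorem Move.data_eq (h : Move t s p s' p') {j : Fin n} (he : p.executes ≠ some j)
    (hr : p.readies j = 0) : (∀ l, s'.data l j = s.data l j) ∧
      s'.lastWrittenLocations j = s.lastWrittenLocations j ∧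
      s'.lastReadSet j = s.lastReadSet j := by
  cases h <;> simp_all [PC.executes, PC.readies] <;> grind

/-! ### Counters -/

/-- The contribution of a thread to the number of active tasks. -/
def PC.active : PC n Loc Val σ → ℤ
  | .loop none | .joined | .nextTask | .nextTaskCompare _ | .nvvCheck | .nvvIncrActive
  | .nveCheck | .nveIncrActive | .cdCount | .cdExecutionIdx _ | .cdValidationIdx _
  | .cdActive _ | .cdRecount _ | .cdSet => 0
  | _ => 1

/-- The count of active tasks is exact until a thread joins with a task in its hands, and then the
done marker is set. -/
theorem Move.numActiveTasks (h : Move t s p s' p') (hs : s'.doneMarker = false) :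
    s.doneMarker = false ∧ s'.numActiveTasks + p.active = s.numActiveTasks + p'.active := by
  cases h <;> simp_all [PC.active]

/-- Whether a thread is about to fetch a validation index. -/
def PC.fetchesValidation : PC n Loc Val σ → ℕ
  | .nvvIncrActive | .nvvFetch => 1
  | _ => 0

/-- Whether a thread is about to fetch an execution index. -/
def PC.fetchesExecution : PC n Loc Val σ → ℕ
  | .nveIncrActive | .nveFetch => 1
  | _ => 0

theorem Move.validationIdx_add_le (h : Move t s p s' p') :
    s'.validationIdx + p'.fetchesValidation ≤ s.validationIdx + p.fetchesValidation ∨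
      s'.validationIdx < n := by
  cases h <;> simp_all [PC.fetchesValidation]

theorem Move.executionIdx_add_le (h : Move t s p s' p') :
    s'.executionIdx + p'.fetchesExecution ≤ s.executionIdx + p.fetchesExecution ∨
      s'.executionIdx < n := by
  cases h <;> simp_all [PC.fetchesExecution]

end StepLemmas

section Invariants

variable {m n : ℕ} {Loc Val σ : Type*}

/-! ### Invariants of a run -/

theorem sum_update_add {ι α M : Type*} [Fintype ι] [DecidableEq ι] [AddCommMonoid M] (x : ι → α)
    (f : α → M) (t : ι) (a : α) :
    ∑ i, f (Function.update x t a i) + f (x t) = ∑ i, f (x i) + f a := by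
  rw [Fintype.sum_eq_add_sum_compl t fun i => f (Function.update x t a i),
    Fintype.sum_eq_add_sum_compl t fun i => f (x i),
    Finset.sum_congr (g := fun i => f (x i)) rfl fun i hi => by
      rw [Function.update_of_ne (by simpa using hi)], Function.update_self]
  ac_rfl

theorem le_sum_univ {ι : Type*} [Fintype ι] (f : ι → ℕ) (i : ι) : f i ≤ ∑ i, f i :=
  Finset.single_le_sum (fun _ _ => Nat.zero_le _) (Finset.mem_univ i)

theorem add_le_sum_univ {ι : Type*} [Fintype ι] (f : ι → ℕ) {i j : ι} (h : i ≠ j) :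
    f i + f j ≤ ∑ i, f i := by
  classical
  rw [← Finset.sum_pair h]
  exact Finset.sum_le_sum_of_subset (Finset.subset_univ _)

/-- What holds at every time of every run. The bounds `executions` and `aborts` say that a
transaction has at most one owner: it is the thread that executes it, or the thread or the set of
dependencies which keeps it until it is ready again. -/
structure Config.Invariant (c : Config m n Loc Val σ) : Prop where
  holder : ∀ t ℓ, c.shared.holder ℓ = some t ↔ (c.pc t).Holds ℓ
  checked : ∀ t, (c.pc t).CheckedStatus c.shared
  executions : ∀ j, ∑ t, (c.pc t).executions j ≤
    if c.shared.txnStatus j = .executing then 1 else 0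
  aborts : ∀ j, ∑ t, (c.pc t).aborts j + c.shared.dependencies j ≤
    if c.shared.txnStatus j = .aborting then 1 else 0
  versions : ∀ t, (c.pc t).VersionsBounded c.shared
  dependency : ∀ b, ∀ j ∈ c.shared.txnDependency b, b < j
  tracked : ∀ t, (c.pc t).EstimatesTracked c.shared
  estimates : c.shared.EstimatesBounded
  active : c.shared.doneMarker = false → c.shared.numActiveTasks = ∑ t, (c.pc t).active
  validationIdx : c.shared.validationIdx + ∑ t, (c.pc t).fetchesValidation ≤ n + m
  executionIdx : c.shared.executionIdx + ∑ t, (c.pc t).fetchesExecution ≤ n + m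

namespace Config.Invariant

theorem init : (Config.init m n Loc Val σ).Invariant where
  holder t ℓ := by simp [Config.init, Shared.init, PC.Holds]
  checked t := by simp [Config.init, PC.CheckedStatus]
  executions j := by simp [Config.init, PC.executions, PC.executes]
  aborts j := by
    simp [Config.init, Shared.init, PC.aborts, PC.readies, PC.suspends, Shared.dependencies]
  versions t := by simp [Config.init, PC.VersionsBounded]
  dependency b j := by simp [Config.init, Shared.init]
  tracked t := by simp [Config.init, PC.EstimatesTracked]
  estimates l b := by simp [Config.init, Shared.init]
  active _ := by simp [Config.init, Shared.init, PC.active]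
  validationIdx := by simp [Config.init, Shared.init, PC.fetchesValidation]
  executionIdx := by simp [Config.init, Shared.init, PC.fetchesExecution]

variable {c : Config m n Loc Val σ} (hc : c.Invariant)
include hc

theorem executions_le (t : Fin m) (j : Fin n) :
    (c.pc t).executions j ≤ if c.shared.txnStatus j = .executing then 1 else 0 :=
  (le_sum_univ (fun t => (c.pc t).executions j) t).trans (hc.executions j)

theorem aborts_add_le (t : Fin m) (j : Fin n) :
    (c.pc t).aborts j + c.shared.dependencies j ≤
      if c.shared.txnStatus j = .aborting then 1 else 0 :=
  (Nat.add_le_add_right (le_sum_univ (fun t => (c.pc t).aborts j) t) _).trans (hc.aborts j)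

theorem aborts_le (t : Fin m) (j : Fin n) :
    (c.pc t).aborts j ≤ if c.shared.txnStatus j = .aborting then 1 else 0 :=
  (Nat.le_add_right _ _).trans (hc.aborts_add_le t j)

variable [DecidableEq Loc] [DecidableEq Val] {t : Fin m} {s' : Shared m n Loc Val}
  {p' : PC n Loc Val σ}

theorem stage_le (h : Move t c.shared (c.pc t) s' p') (j : Fin n) :
    c.shared.stage j ≤ s'.stage j :=
  h.stage_le (hc.checked t) j (hc.executions_le t j)

/-- A thread does not write the data of a transaction that another thread owns. -/
theorem data_eq_of_ne (h : Move t c.shared (c.pc t) s' p') {u : Fin m} (hu : u ≠ t) {j : Fin n}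
    (hj : (c.pc u).executes = some j ∨ 0 < (c.pc u).readies j) :
    (∀ l, s'.data l j = c.shared.data l j) ∧
      s'.lastWrittenLocations j = c.shared.lastWrittenLocations j ∧
      s'.lastReadSet j = c.shared.lastReadSet j := by
  have he := (add_le_sum_univ (fun t => (c.pc t).executions j) hu).trans (hc.executions j)
  have ha := (add_le_sum_univ (fun t => (c.pc t).aborts j) hu).trans
    ((Nat.le_add_right _ _).trans (hc.aborts j))
  simp only [PC.executions, PC.aborts] at he ha
  refine h.data_eq (fun ht => ?_) (Nat.eq_zero_of_not_pos fun ht => ?_)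
  all_goals
    rcases hj with hj | hj <;> simp_all <;> grind

theorem move (h : Move t c.shared (c.pc t) s' p') :
    Config.Invariant ⟨s', Function.update c.pc t p'⟩ where
  holder u ℓ := by
    by_cases hu : u = t
    · subst hu
      simpa using h.holder_self (hc.holder u) ℓ
    · simpa [hu] using (h.holder_other (hc.holder t) hu ℓ).trans (hc.holder u ℓ)
  checked u := by
    -- the lock of a status protects it from the steps of other threads
    by_cases hu : u = t
    · subst hu
      simpa using h.checkedStatus_self (hc.checked u)
    · simp only [ne_eq, hu, not_false_eq_true, Function.update_of_ne]
      refine (hc.checked u).congr fun j hj => ?_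
      by_contra hne
      have ht := h.holds_status_of_ne (j := j) (by tauto)
      rw [← hc.holder] at ht hj
      exact hu (Option.some.inj (hj.symm.trans ht))
  executions j := by
    have h1 := h.executions_add_le (hc.checked t) j (hc.executions_le t j) (hc.aborts_le t j)
    have h2 := sum_update_add c.pc (fun p => p.executions j) t p'
    have h3 := hc.executions j
    simp only at h2 ⊢
    omega
  aborts j := by
    have h1 := h.aborts_add_le (hc.checked t) j (hc.executions_le t j) (hc.aborts_add_le t j)
    have h2 := sum_update_add c.pc (fun p => p.aborts j) t p'
    have h3 := hc.aborts j
    simp only at h2 ⊢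
    omega
  versions u := by
    by_cases hu : u = t
    · subst hu
      simpa using h.versionsBounded (hc.versions u) (hc.stage_le h)
    · simpa [hu] using (hc.versions u).mono (hc.stage_le h)
  dependency b j hj := by
    by_cases hi : ∃ v b, c.pc t = .adInsert v b
    · obtain ⟨v, b', hp⟩ := hi
      have hv := hc.versions t
      rw [hp] at h hv
      cases h with
      | blocked hp => simp [PC.waits] at hp
      | adInsert =>
        have := hc.dependency b j
        by_cases hb : b = b' <;> simp_all [PC.VersionsBounded]
        grind
    by_cases hs : ∃ v w, c.pc t = .feSwap v w
    · obtain ⟨v, w, hp⟩ := hs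
      rw [hp] at h
      cases h with
      | blocked hp => simp [PC.waits] at hp
      | feSwap =>
        have := hc.dependency b j
        by_cases hb : b = v.1 <;> simp_all
    · rw [h.txnDependency_eq (by grind) (by grind)] at hj
      exact hc.dependency b j hj
  tracked u := by
    by_cases hu : u = t
    · subst hu
      simpa using h.estimatesTracked (hc.tracked u) hc.estimates
    · simp only [ne_eq, hu, not_false_eq_true, Function.update_of_ne]
      refine (hc.tracked u).congr fun j hj => ?_
      have := hc.data_eq_of_ne h hu hj
      exact ⟨this.1, this.2.1⟩
  estimates := h.estimatesBounded (hc.tracked t) (hc.aborts_le t) hc.estimates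
  active hd := by
    obtain ⟨hd, h1⟩ := h.numActiveTasks hd
    have h2 := sum_update_add c.pc PC.active t p'
    have h3 := hc.active hd
    simp only
    omega
  validationIdx := by
    have h1 := h.validationIdx_add_le
    have h2 := sum_update_add c.pc PC.fetchesValidation t p'
    have h3 := hc.validationIdx
    -- an index below `n` is less than `n + m` after all pending fetches
    have h4 : ∑ u, (Function.update c.pc t p' u).fetchesValidation ≤ m := by
      refine (Finset.sum_le_card_nsmul _ _ 1 fun u _ => ?_).trans (by simp)
      unfold PC.fetchesValidation
      split <;> simp
    simp only
    omega
  executionIdx := by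
    have h1 := h.executionIdx_add_le
    have h2 := sum_update_add c.pc PC.fetchesExecution t p'
    have h3 := hc.executionIdx
    have h4 : ∑ u, (Function.update c.pc t p' u).fetchesExecution ≤ m := by
      refine (Finset.sum_le_card_nsmul _ _ 1 fun u _ => ?_).trans (by simp)
      unfold PC.fetchesExecution
      split <;> simp
    simp only
    omega

end Config.Invariant

end Invariants

section Potentials

attribute [local simp] Shared.setHolder Shared.setStatus Shared.setData Function.update_apply

variable {m n : ℕ} {Loc Val σ : Type*}

/-! ### Validations of a stable incarnation -/

/-- All descriptors in `R` are confirmed by the results `f` of new reads. -/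
def Valid (f : Loc → ReadResult n Val) (R : ReadSet n Loc) : Prop :=
  ∀ r ∈ R, readStillValid r.2 (f r.1)

/-- The read sets for the current incarnation of `j` in the hands of a thread are confirmed by the
results `f` of reads, and the thread has not seen a failure of the validation of that
incarnation. -/
def PC.ReadsValid (s : Shared m n Loc Val) (f : Loc → ReadResult n Val) (j : Fin n) :
    PC n Loc Val σ → Prop
  | .vm v _ R _ | .recWrite v R _ _ | .recLoad v R _ | .recRemove v R _ _ _
  | .recStoreLocs v R _ _ | .recStoreReads v R _ => v.1 = j → Valid f R
  | .feLockStatus v _ | .feSetExecuted v _ => v.1 = j → Valid f (s.lastReadSet j)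
  | .vrLoop v rest =>
      v.1 = j → v.2 = s.txnIncarnation j → s.txnStatus j = .executed → Valid f rest
  | .vaLock v | .vaCheck v => v.1 = j → v.2 = s.txnIncarnation j → s.txnStatus j ≠ .executed
  | .vaSet v => v.1 ≠ j
  | _ => True

section

variable [DecidableEq Loc] [DecidableEq Val]
variable {t : Fin m} {s s' : Shared m n Loc Val} {p p' : PC n Loc Val σ}

theorem Move.readsValid (h : Move t s p s' p') {f : Loc → ReadResult n Val} {j : Fin n}
    (hf : ∀ l, s.read l j = f l) (hi : s'.txnIncarnation j = s.txnIncarnation j)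
    (hc : p.CheckedStatus s) (hv : p.VersionsBounded s)
    (he : p.executions j ≤ if s.txnStatus j = .executing then 1 else 0)
    (hp : p.ReadsValid s f j) (hR : s.txnStatus j = .executed → Valid f (s.lastReadSet j)) :
    p'.ReadsValid s' f j ∧ (s'.txnStatus j = .executed → Valid f (s'.lastReadSet j)) := by
  cases h <;> simp_all [PC.ReadsValid, PC.CheckedStatus, PC.VersionsBounded, PC.executions,
    PC.executes] <;> grind [Valid, readStillValid]

theorem Move.txnStatus_of_executed (h : Move t s p s' p') {j : Fin n}
    (he : p.executions j ≤ if s.txnStatus j = .executing then 1 else 0)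
    (hs : s'.txnStatus j = .executed) : s.txnStatus j = .executed ∨ s.txnStatus j = .executing := by
  cases h <;> simp_all [PC.executions, PC.executes] <;> grind

theorem Move.txnStatus_of_txnIncarnation_ne (h : Move t s p s' p') {j : Fin n}
    (hj : s'.txnIncarnation j ≠ s.txnIncarnation j) : s'.txnStatus j = .readyToExecute := by
  cases h <;> simp_all

end

/-! ### The number of incarnations -/

/-- Whether a thread has set the status of a transaction below `j` to executed, and has not yet
emptied its set of dependencies. -/
def PC.swapsBelow : PC n Loc Val σ → Fin n → ℕ
  | .feUnlockStatus v _, j | .feLockDep v _, j | .feSwap v _, j => if v.1 < j then 1 else 0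
  | _, _ => 0

variable [DecidableEq Loc] [DecidableEq Val]
variable {t : Fin m} {s s' : Shared m n Loc Val} {p p' : PC n Loc Val σ}

theorem Move.readies_add_le (h : Move t s p s' p') {j : Fin n}
    (hc : p.CheckedStatus s) (hd : ∀ b, j ∈ s.txnDependency b → b < j)
    (hs : ∀ i < j, s'.stage i = s.stage i) (hp : ∀ v, v.1 = j → p ≠ .vaSet v)
    (he : ∀ i, p.executions i ≤ if s.txnStatus i = .executing then 1 else 0) :
    2 * p'.swapsBelow j + p'.readies j + s'.txnIncarnation j ≤
      2 * p.swapsBelow j + p.readies j + s.txnIncarnation j := by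
  simp only [Shared.stage_eq_iff] at hs
  cases h <;> simp_all [PC.swapsBelow, PC.readies, PC.CheckedStatus, PC.executions, PC.executes,
    ReadyCaller.readies] <;> grind

/-! ### The number of writes of one incarnation -/

/-- The phase of the writes for transaction `j` which a thread performs before the status of `j`
changes, counted from the last one. -/
def PC.dataPhase (p : PC n Loc Val σ) (j : Fin n) : ℕ :=
  match p with
  | .recWrite v _ _ _ => if v.1 = j then 3 else 0
  | .recLoad v _ _ | .vaUnlock v true | .ceLoad v => if v.1 = j then 2 else 0
  | .recRemove v _ _ _ _ | .ceLoop v _ => if v.1 = j then 1 else 0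
  | .recStoreLocs _ _ _ _ | .recStoreReads _ _ _ | .feLockStatus _ _ | .feSetExecuted _ _ => 0
  | p => if p.executes = some j then 4 else 0

/-- The number of writes for transaction `j` which remain in the current phase. -/
def PC.dataSize : PC n Loc Val σ → Fin n → ℕ
  | .recWrite v _ _ rest, j => if v.1 = j then rest.card else 0
  | .recRemove v _ _ _ rest, j | .ceLoop v rest, j => if v.1 = j then rest.card else 0
  | _, _ => 0

/-- What remains of the writes for transaction `j` which a thread performs before the status of `j`
changes. -/
def PC.dataWork (p : PC n Loc Val σ) (j : Fin n) : ℕ ×ₗ ℕ :=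
  toLex (p.dataPhase j, p.dataSize j)

theorem Move.dataWork_le (h : Move t s p s' p') {j : Fin n} (hc : p.CheckedStatus s)
    (hs : s'.stage j = s.stage j) : p'.dataWork j ≤ p.dataWork j ∧
      ((∃ l, s'.data l j ≠ s.data l j) → p'.dataWork j < p.dataWork j) := by
  rw [Shared.stage_eq_iff] at hs
  simp only [PC.dataWork, Prod.Lex.toLex_le_toLex, Prod.Lex.toLex_lt_toLex]
  cases h
  case join task h =>
    rcases task with _ | (v | v) <;> simp [PC.dataPhase, PC.dataSize, PC.executes]
    grind
  all_goals
    simp_all [PC.dataPhase, PC.dataSize, PC.executes, PC.CheckedStatus]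
  all_goals grind [Finset.card_pos]

/-! ### The number of decreases of the indices -/

/-- A bound for the remaining decreases of the indices, and increments of their count, by a thread
in its current task. -/
def PC.decreases : PC n Loc Val σ → ℕ
  | .feUnlockStatus _ _ | .feLockDep _ _ | .feSwap _ _ | .feUnlockDep _ _ _ | .rdLoop _ _ _ _
  | .srLock _ (.resumeDependencies _ _ _ _) | .srRead _ (.resumeDependencies _ _ _ _)
  | .srWrite _ _ (.resumeDependencies _ _ _ _) | .srUnlock _ (.resumeDependencies _ _ _ _)
  | .rdDecrExecutionIdx _ _ _ => 4
  | .rdCountDecr _ _ => 3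
  | .feCheckValidationIdx _ _ | .feDecrValidationIdx _ => 2
  | .feCountDecr _ => 1
  | .vaUnlock _ true | .ceLoad _ | .ceLoop _ _
  | .srLock _ (.finishValidation _) | .srRead _ (.finishValidation _)
  | .srWrite _ _ (.finishValidation _) | .srUnlock _ (.finishValidation _)
  | .fvDecrValidationIdx _ => 2
  | .fvCountDecr _ => 1
  | _ => 0

theorem Move.decreases_le (h : Move t s p s' p') (hc : p.CheckedStatus s)
    (he : ∀ i, p.executions i ≤ if s.txnStatus i = .executing then 1 else 0)
    (hs : ∀ i, s'.stage i = s.stage i) : p'.decreases ≤ p.decreases ∧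
      (s'.decreaseCnt ≠ s.decreaseCnt ∨ s'.validationIdx < s.validationIdx ∨
        s'.executionIdx < s.executionIdx → p'.decreases < p.decreases) := by
  simp only [Shared.stage_eq_iff] at hs
  cases h
  case srLock j c _ => cases c <;> simp [PC.decreases]
  case srRead j c => cases c <;> simp [PC.decreases]
  case srWrite j i c =>
    have := hs j
    simp_all [PC.CheckedStatus]
  all_goals
    simp_all [PC.decreases, PC.executions, PC.executes, PC.CheckedStatus]
  all_goals grind

end Potentials

section Work

attribute [local simp] Shared.setHolder Shared.setStatus Shared.setData Function.update_apply

variable {m n : ℕ} {Loc Val σ : Type*}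

/-! ### The work of a thread in a quiet period -/

/-- The thread has no task and is not about to fetch one. -/
def PC.Idle : PC n Loc Val σ → Prop
  | .loop none | .joined | .nextTask | .nextTaskCompare _ | .nvvCheck | .nveCheck | .cdCount
  | .cdExecutionIdx _ | .cdValidationIdx _ | .cdActive _ | .cdRecount _ | .cdSet => True
  | _ => False

/-- The distance of a program counter from the end of the task, when no status and no index changes
any more. A call of `add_dependency` whose blocking transaction is executed comes before the
repeated call of `VM.execute`, any other one comes after it. Steps that change a status or an index
need not decrease this number. -/
def PC.phase (executed : Fin n → Prop) [DecidablePred executed] : PC n Loc Val σ → ℕ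
  | .loop none | .joined | .nextTask | .nextTaskCompare _ | .nvvCheck | .nveCheck | .cdCount
  | .cdExecutionIdx _ | .cdValidationIdx _ | .cdActive _ | .cdRecount _ | .cdSet => 2
  | .nvvIncrActive | .nveIncrActive => 1
  | .nvvFetch | .nveFetch => 0
  | .nvvLock _ => 12
  | .nvvRead _ => 11
  | .nvvUnlock _ _ => 10
  | .loop (some (.validation _)) => 9
  | .vrLoad _ => 8
  | .vrLoop _ _ => 7
  | .vaLock _ => 6
  | .vaCheck _ => 5
  | .vaSet _ | .vaUnlock _ false => 4
  | .vaUnlock _ true => 9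
  | .ceLoad _ => 8
  | .ceLoop _ _ => 7
  | .srLock _ _ => 6
  | .srRead _ _ => 5
  | .srWrite _ _ _ => 4
  | .srUnlock _ (.finishValidation _) => 10
  | .fvDecrValidationIdx _ => 9
  | .fvCountDecr _ => 8
  | .fvCheckExecutionIdx _ => 7
  | .incLock _ _ => 6
  | .incCheck _ _ => 5
  | .incSet _ _ | .incUnlock _ _ none => 4
  | .incGet _ _ => 25
  | .incUnlock _ _ (some _) => 24
  | .loop (some (.execution _)) => 23
  | .adLockDep _ b => if executed b then 22 else 16
  | .adLockBlocking _ b => if executed b then 21 else 15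
  | .adReadBlocking _ b => if executed b then 20 else 14
  | .adUnlockBlocking _ _ true => 19
  | .adUnlockRetry _ _ => 18
  | .vm _ _ _ _ => 17
  | .adUnlockBlocking _ _ false => 13
  | .adLockStatus _ _ => 12
  | .adSetAborting _ _ => 11
  | .recWrite _ _ _ _ => 10
  | .recLoad _ _ _ => 9
  | .recRemove _ _ _ _ _ => 8
  | .recStoreLocs _ _ _ _ => 7
  | .recStoreReads _ _ _ => 6
  | .feLockStatus _ _ => 5
  | .feSetExecuted _ _ => 4
  | .feUnlockStatus _ _ => 16
  | .feLockDep _ _ => 15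
  | .feSwap _ _ => 14
  | .feUnlockDep _ _ _ | .srUnlock _ (.resumeDependencies _ _ _ _) => 13
  | .rdLoop _ _ _ _ => 12
  | .rdDecrExecutionIdx _ _ _ => 11
  | .rdCountDecr _ _ => 10
  | .feCheckValidationIdx _ _ => 9
  | .feDecrValidationIdx _ => 5
  | .feCountDecr _ => 4
  | .adUnlockStatus _ _ => 6
  | .adInsert _ _ => 5
  | .adUnlockDep _ _ => 4
  | .decrActive _ => 3

/-- The number of iterations left in the current loop over a set. -/
def PC.iterations : PC n Loc Val σ → ℕ
  | .recWrite _ _ _ rest => rest.card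
  | .recRemove _ _ _ _ rest | .ceLoop _ rest => rest.card
  | .rdLoop _ _ _ rest => rest.card
  | .vrLoop _ rest => rest.card
  | _ => 0

/-- A measure of the steps that a thread can still make in its task, in lexicographic order, when no
status and no index changes any more. -/
def PC.work (executed : Fin n → Prop) [DecidablePred executed] (p : PC n Loc Val σ) : ℕ ×ₗ ℕ :=
  toLex (p.phase executed, p.iterations)

variable [DecidableEq Loc] [DecidableEq Val]
variable {t : Fin m} {s s' : Shared m n Loc Val} {p p' : PC n Loc Val σ}

/-- In a quiet period, every step is progress, unless the thread is idle, blocked by a lock, or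
in the virtual machine. -/
theorem Move.work_lt (h : Move t s p s' p') (hc : p.CheckedStatus s)
    (he : ∀ i, p.executions i ≤ if s.txnStatus i = .executing then 1 else 0)
    (hE : s.EstimatesBounded) (hs : ∀ i, s'.stage i = s.stage i)
    (hv : s'.validationIdx = s.validationIdx) (hx : s'.executionIdx = s.executionIdx) :
    p'.work (fun i => s.txnStatus i = .executed) < p.work (fun i => s.txnStatus i = .executed) ∨
      (p' = p ∧ ∃ ℓ, p.waits = some ℓ ∧ s.holder ℓ ≠ none) ∨ (p.InVM ∧ p'.InVM) ∨
      (p.Idle ∧ p'.Idle) := by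
  simp only [Shared.stage_eq_iff] at hs
  simp only [PC.work, Prod.Lex.toLex_lt_toLex]
  cases h
  case blocked => exact .inr (.inl ⟨rfl, _, ‹_›, ‹_›⟩)
  case join task h =>
    rcases task with _ | (v | v) <;> simp [PC.phase, PC.Idle]
  case vmReadError b hr =>
    have := (hE _ _ (Shared.of_read_eq_readError hr).2).1
    simp [PC.phase, this]
  case srWrite j i c =>
    have := hs j
    simp_all [PC.CheckedStatus]
  all_goals
    simp_all [PC.phase, PC.iterations, PC.CheckedStatus, PC.executions, PC.executes, PC.Idle,
      PC.InVM]
  all_goals grind [Finset.card_pos]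

end Work

section RunLemmas

open Filter

variable {m n : ℕ} {Loc Val σ : Type*}

/-! ### Sequences that become constant -/

theorem eventually_succ_eq_of_succ_le {α : Type*} [PartialOrder α] [WellFoundedLT α] {f : ℕ → α}
    (h : ∀ᶠ T in atTop, f (T + 1) ≤ f T) : ∀ᶠ T in atTop, f (T + 1) = f T := by
  obtain ⟨T₀, h⟩ := eventually_atTop.1 h
  obtain ⟨-, ⟨T₁, hT₁, rfl⟩, hmin⟩ :=
    WellFounded.has_min (wellFounded_lt (α := α)) (f '' Set.Ici T₀) ⟨_, T₀, Set.self_mem_Ici, rfl⟩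
  have hle : ∀ T ≥ T₁, f T = f T₁ := by
    intro T hT
    induction T, hT using Nat.le_induction with
    | base => rfl
    | succ T hT ih =>
      have hT₀ : T₀ ≤ T := le_trans hT₁ hT
      exact ((ih ▸ h T hT₀).lt_or_eq).resolve_left
        (hmin _ ⟨T + 1, Nat.le_succ_of_le hT₀, rfl⟩)
  filter_upwards [eventually_ge_atTop T₁] with T hT
  rw [hle T hT, hle (T + 1) (by omega)]

theorem eventually_succ_eq_of_le_succ {f : ℕ → ℕ} {b : ℕ} (hb : ∀ᶠ T in atTop, f T ≤ b)
    (h : ∀ᶠ T in atTop, f T ≤ f (T + 1)) : ∀ᶠ T in atTop, f (T + 1) = f T := by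
  have hb' : ∀ᶠ T in atTop, f (T + 1) ≤ b := (tendsto_add_atTop_nat 1).eventually hb
  have := eventually_succ_eq_of_succ_le (f := fun T => b - f T)
    (h.mono fun T hT => Nat.sub_le_sub_left hT b)
  filter_upwards [this, hb, hb'] with T h1 h2 h3
  omega

theorem eq_of_succ_eq {α : Type*} {f : ℕ → α} {T₀ : ℕ} (h : ∀ T ≥ T₀, f (T + 1) = f T) :
    ∀ T ≥ T₀, f T = f T₀ := by
  intro T hT
  induction T, hT using Nat.le_induction with
  | base => rfl
  | succ T hT ih => rw [h T hT, ih]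

/-! ### Stable incarnations -/

theorem Shared.read_congr {s s' : Shared m n Loc Val} {j : Fin n}
    (h : ∀ i < j, ∀ l, s'.data l i = s.data l i) (l : Loc) : s'.read l j = s.read l j := by
  have hS : (Finset.univ.filter fun i => i < j ∧ (s'.data l i).isSome) =
      Finset.univ.filter fun i => i < j ∧ (s.data l i).isSome := by
    ext i
    simp only [Finset.mem_filter, Finset.mem_univ, true_and]
    exact and_congr_right fun hi => by rw [h i hi]
  unfold Shared.read
  simp only [hS]
  split_ifs with hne
  · have := Finset.max'_mem _ hne
    rw [h _ (by simp_all)]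
  · rfl

theorem PC.ReadsValid.congr {s s' : Shared m n Loc Val} {p : PC n Loc Val σ}
    {f : Loc → ReadResult n Val} {j : Fin n} (hp : p.ReadsValid s f j)
    (hv : p.VersionsBounded s) (hi : s'.txnIncarnation j = s.txnIncarnation j)
    (hr : p.executes = some j → s'.lastReadSet j = s.lastReadSet j)
    (hs : s'.txnStatus j = .executed → s.txnStatus j = .executed ∨ s.txnStatus j = .executing) :
    p.ReadsValid s' f j := by
  -- a validation of the current incarnation cannot have begun before its execution has ended
  have hstage : ∀ v : Version n, v.1 = j → v.2 = s.txnIncarnation j →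
      4 * v.2 + 2 ≤ s.stage v.1 → s.txnStatus j ≠ .executing := by
    rintro v rfl hv h hs
    simp [Shared.stage, hs, Status.rank, hv] at h
  cases p
  case vrLoop v rest =>
    intro h1 h2 h3
    rw [hi] at h2
    exact hp h1 h2 ((hs h3).resolve_right (hstage v h1 h2 hv))
  case vaLock v =>
    intro h1 h2 h3
    rw [hi] at h2
    exact hp h1 h2 ((hs h3).resolve_right (hstage v h1 h2 hv))
  case vaCheck v =>
    intro h1 h2 h3
    rw [hi] at h2
    exact hp h1 h2 ((hs h3).resolve_right (hstage v h1 h2 hv))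
  all_goals simp_all [PC.ReadsValid, PC.executes]

/-- The current incarnation of `j` is, and will be, confirmed by the results `f` of reads. -/
structure Config.ReadsValid (c : Config m n Loc Val σ) (f : Loc → ReadResult n Val) (j : Fin n) :
    Prop where
  thread : ∀ t, (c.pc t).ReadsValid c.shared f j
  recorded : c.shared.txnStatus j = .executed → Valid f (c.shared.lastReadSet j)

theorem Config.Invariant.readsValid_of_ready {c : Config m n Loc Val σ} (hc : c.Invariant)
    {f : Loc → ReadResult n Val} {j : Fin n} (hj : c.shared.txnStatus j = .readyToExecute) :
    c.ReadsValid f j where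
  thread t := by
    have he := hc.executions_le t j
    have hk := hc.checked t
    cases hp : c.pc t <;> simp_all [PC.ReadsValid, PC.executions, PC.executes, PC.CheckedStatus]
    rintro rfl
    simp_all
  recorded h := by simp_all

variable [DecidableEq Loc] [DecidableEq Val]

theorem Config.Invariant.readsValid_move {c : Config m n Loc Val σ} (hc : c.Invariant)
    {t : Fin m} {s' : Shared m n Loc Val} {p' : PC n Loc Val σ}
    (h : Move t c.shared (c.pc t) s' p') {f : Loc → ReadResult n Val} {j : Fin n}
    (hf : ∀ l, c.shared.read l j = f l) (hj : c.ReadsValid f j) :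
    Config.ReadsValid ⟨s', Function.update c.pc t p'⟩ f j := by
  by_cases hi : s'.txnIncarnation j = c.shared.txnIncarnation j
  swap
  · exact (hc.move h).readsValid_of_ready (h.txnStatus_of_txnIncarnation_ne hi)
  have ht := h.readsValid hf hi (hc.checked t) (hc.versions t) (hc.executions_le t j)
    (hj.thread t) hj.recorded
  refine ⟨fun u => ?_, ht.2⟩
  by_cases hu : u = t
  · subst hu
    simpa using ht.1
  simp only [ne_eq, hu, not_false_eq_true, Function.update_of_ne]
  exact (hj.thread u).congr (hc.versions u) hi
    (fun he => (hc.data_eq_of_ne h hu (.inl he)).2.2)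
    (h.txnStatus_of_executed (hc.executions_le t j))

variable {B : Block n Loc Val σ} (ρ : Run m B)

theorem Run.config_succ (T : ℕ) : ρ.config (T + 1) = ρ.config T ∨
    ∃ t s' p', ρ.sched T = some t ∧ Move t (ρ.config T).shared ((ρ.config T).pc t) s' p' ∧
      ρ.config (T + 1) = ⟨s', Function.update (ρ.config T).pc t p'⟩ := by
  cases h : ρ.sched T with
  | none => exact .inl (ρ.eq_of_none T h)
  | some t =>
    obtain ⟨q, hq, e⟩ := ρ.step_of_some T t h
    exact .inr ⟨t, q.1, q.2, rfl, Move.of_next hq, e⟩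

theorem Run.invariant (T : ℕ) : (ρ.config T).Invariant := by
  induction T with
  | zero => exact ρ.init_eq ▸ Config.Invariant.init
  | succ T ih =>
    obtain e | ⟨t, s', p', -, h, e⟩ := ρ.config_succ T
    · rwa [e]
    · rw [e]
      exact ih.move h

theorem Run.stage_le_succ (T : ℕ) (j : Fin n) :
    (ρ.config T).shared.stage j ≤ (ρ.config (T + 1)).shared.stage j := by
  obtain e | ⟨t, s', p', -, h, e⟩ := ρ.config_succ T
  · rw [e]
  · rw [e]
    exact (ρ.invariant T).stage_le h j

/-- If the transactions below `j` are stable, then `j` has finitely many incarnations: every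
incarnation that begins from then on reads what its validations read, hence is not aborted by them,
and the executions of stable transactions resume `j` finitely often. -/
theorem Run.exists_stage_le (j : Fin n) {T₀ : ℕ} (h₀ : ∀ T ≥ T₀, ∀ i < j,
      (ρ.config (T + 1)).shared.stage i = (ρ.config T).shared.stage i ∧
        ∀ l, (ρ.config (T + 1)).shared.data l i = (ρ.config T).shared.data l i) :
    ∃ b, ∀ᶠ T in atTop, (ρ.config T).shared.stage j ≤ b := by
  suffices h : ∃ b, ∀ᶠ T in atTop, (ρ.config T).shared.txnIncarnation j ≤ b by
    obtain ⟨b, hb⟩ := h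
    refine ⟨4 * b + 3, hb.mono fun T hT => ?_⟩
    have := ((ρ.config T).shared.txnStatus j).rank_le
    unfold Shared.stage
    omega
  by_cases hinc : ∀ T ≥ T₀,
      (ρ.config (T + 1)).shared.txnIncarnation j = (ρ.config T).shared.txnIncarnation j
  · refine ⟨(ρ.config T₀).shared.txnIncarnation j, ?_⟩
    filter_upwards [eventually_ge_atTop T₀] with T hT
    exact (eq_of_succ_eq (f := fun T => (ρ.config T).shared.txnIncarnation j) hinc T hT).le
  push Not at hinc
  obtain ⟨T₁, hT₁, hne⟩ := hinc
  set f : Loc → ReadResult n Val := fun l => (ρ.config T₀).shared.read l j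
  have hread : ∀ T ≥ T₀, ∀ l, (ρ.config T).shared.read l j = f l := fun T hT l =>
    eq_of_succ_eq (f := fun T => (ρ.config T).shared.read l j)
      (fun T hT => Shared.read_congr (fun i hi => (h₀ T hT i hi).2) l) T hT
  -- when a new incarnation begins, no thread has read anything for it
  have hvalid : ∀ T ≥ T₁ + 1, (ρ.config T).ReadsValid f j := by
    intro T hT
    induction T, hT using Nat.le_induction with
    | base =>
      refine (ρ.invariant _).readsValid_of_ready ?_
      obtain e | ⟨t, s', p', -, h, e⟩ := ρ.config_succ T₁
      · exact absurd (by rw [e]) hne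
      · rw [e] at hne ⊢
        exact h.txnStatus_of_txnIncarnation_ne hne
    | succ T hT ih =>
      obtain e | ⟨t, s', p', -, h, e⟩ := ρ.config_succ T
      · rwa [e]
      · rw [e]
        exact (ρ.invariant T).readsValid_move h (hread T (by omega)) ih
  -- a pending swap of a set of dependencies yields at most one resumption of `j`, and as it is gone
  -- itself, the weight two makes up for that
  set g : ℕ → ℕ := fun T => 2 * ∑ t, ((ρ.config T).pc t).swapsBelow j +
    ∑ t, ((ρ.config T).pc t).readies j + (ρ.config T).shared.txnIncarnation j with hg
  have hanti : ∀ T ≥ T₁ + 1, g T ≤ g (T₁ + 1) := by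
    intro T hT
    induction T, hT using Nat.le_induction with
    | base => rfl
    | succ T hT ih =>
      refine le_trans ?_ ih
      obtain e | ⟨t, s', p', -, h, e⟩ := ρ.config_succ T
      · simp only [hg, e, le_refl]
      · have h0 := h₀ T (by omega)
        have hI := ρ.invariant T
        have hR := (hvalid T hT).thread t
        have h1 := sum_update_add (ρ.config T).pc (fun p => p.swapsBelow j) t p'
        have h2 := sum_update_add (ρ.config T).pc (fun p => p.readies j) t p'
        simp only [e] at h0
        have h3 := h.readies_add_le (j := j) (hI.checked t) (fun b hb => hI.dependency b j hb)
          (fun i hi => (h0 i hi).1)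
          (fun v hv hp => by rw [hp] at hR; exact hR hv) (hI.executions_le t)
        simp only [hg, e]
        omega
  refine ⟨g (T₁ + 1), ?_⟩
  filter_upwards [eventually_ge_atTop (T₁ + 1)] with T hT
  exact le_trans (Nat.le_add_left _ _) (hanti T hT)

/-- By induction on `j`: the status, the incarnation and the data of every transaction are
eventually constant. -/
theorem Run.eventually_stage_data_eq (j : Fin n) : ∀ᶠ T in atTop,
    (ρ.config (T + 1)).shared.stage j = (ρ.config T).shared.stage j ∧
      ∀ l, (ρ.config (T + 1)).shared.data l j = (ρ.config T).shared.data l j := by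
  induction j using WellFoundedLT.induction with
  | ind j ih =>
    have hbelow := eventually_all.2 fun i => eventually_all.2 fun hi : i < j => ih i hi
    obtain ⟨T₀, h₀⟩ := eventually_atTop.1 hbelow
    obtain ⟨b, hb⟩ := ρ.exists_stage_le j h₀
    have hstage := eventually_succ_eq_of_le_succ hb (.of_forall fun T => ρ.stage_le_succ T j)
    have hwork : ∀ᶠ T in atTop, ∀ t,
        ((ρ.config (T + 1)).pc t).dataWork j = ((ρ.config T).pc t).dataWork j := by
      refine eventually_all.2 fun u => eventually_succ_eq_of_succ_le
        (f := fun T => ((ρ.config T).pc u).dataWork j) ?_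
      filter_upwards [hstage] with T hT
      obtain e | ⟨t, s', p', -, h, e⟩ := ρ.config_succ T
      · rw [e]
      · rw [e] at hT ⊢
        by_cases hu : u = t
        · subst hu
          simpa using (h.dataWork_le ((ρ.invariant T).checked u) hT).1
        · simp [hu]
    filter_upwards [hstage, hwork] with T hT hw
    refine ⟨hT, ?_⟩
    obtain e | ⟨t, s', p', -, h, e⟩ := ρ.config_succ T
    · simp [e]
    · have hwt := hw t
      rw [e] at hT hwt ⊢
      by_contra hd
      push Not at hd
      exact ((h.dataWork_le ((ρ.invariant T).checked t) hT).2 hd).ne (by simpa using hwt)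

end RunLemmas

section Liveness

open Filter

attribute [local simp] Shared.setHolder Shared.setStatus Shared.setData Function.update_apply

variable {m n : ℕ} {Loc Val σ : Type*}

/-! ### Quiet periods -/

theorem PC.Idle.active_eq {p : PC n Loc Val σ} (h : p.Idle) : p.active = 0 := by
  unfold PC.Idle at h
  split at h <;> first | rfl | exact h.elim

theorem PC.Idle.work_eq {p : PC n Loc Val σ} (h : p.Idle) (executed : Fin n → Prop)
    [DecidablePred executed] : p.work executed = toLex (2, 0) := by
  unfold PC.Idle at h
  split at h <;> first | rfl | exact h.elim

theorem PC.InVM.work_eq {p : PC n Loc Val σ} (h : p.InVM) (executed : Fin n → Prop)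
    [DecidablePred executed] : p.work executed = toLex (17, 0) := by
  unfold PC.InVM at h
  split at h <;> first | rfl | exact h.elim

theorem PC.Holds.not_idle {p : PC n Loc Val σ} {ℓ : Lock n} (h : p.Holds ℓ) : ¬ p.Idle := by
  cases p <;> simp_all [PC.Holds, PC.Idle]

/-- A thread that waits for a lock holds at most a lock of a set of dependencies, and if it holds
one, then it waits for the lock of a status. -/
theorem PC.Holds.of_waits {p : PC n Loc Val σ} {ℓ ℓ' : Lock n} (h : p.Holds ℓ)
    (hw : p.waits = some ℓ') : (∃ b, ℓ = .dependency b) ∧ ∃ j, ℓ' = .status j := by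
  cases p <;> simp_all [PC.Holds, PC.waits]
  all_goals exact ⟨_, hw.symm⟩

/-- The distance of an idle thread from the loop condition. -/
def PC.idleDistance : PC n Loc Val σ → ℕ
  | .nextTask => 9
  | .nextTaskCompare _ => 8
  | .nvvCheck | .nveCheck => 7
  | .cdCount => 6
  | .cdExecutionIdx _ => 5
  | .cdValidationIdx _ => 4
  | .cdActive _ => 3
  | .cdRecount _ => 2
  | .cdSet => 1
  | _ => 0

variable [DecidableEq Loc] [DecidableEq Val]

theorem Move.idleDistance_lt {t : Fin m} {s s' : Shared m n Loc Val} {p p' : PC n Loc Val σ}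
    (h : Move t s p s' p') (hp : p.Idle) (hp' : p'.Idle) (hl : p ≠ .loop none) :
    p'.idleDistance < p.idleDistance := by
  cases h
  case blocked => cases p <;> simp_all [PC.Idle, PC.waits]
  all_goals simp_all [PC.Idle, PC.idleDistance]

theorem Move.doneMarker {t : Fin m} {s s' : Shared m n Loc Val} {p p' : PC n Loc Val σ}
    (h : Move t s p s' p') (hs : s.doneMarker = true) : s'.doneMarker = true := by
  cases h <;> simp_all

variable {B : Block n Loc Val σ} (ρ : Run m B)

/-- The step at time `T` changes no index and makes no progress in any task. -/
structure Run.QuietAt (T : ℕ) : Prop where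
  decreaseCnt : (ρ.config (T + 1)).shared.decreaseCnt = (ρ.config T).shared.decreaseCnt
  validationIdx : (ρ.config (T + 1)).shared.validationIdx = (ρ.config T).shared.validationIdx
  executionIdx : (ρ.config (T + 1)).shared.executionIdx = (ρ.config T).shared.executionIdx
  thread : ∀ t, ρ.sched T = some t →
    ((ρ.config (T + 1)).pc t = (ρ.config T).pc t ∧
      ∃ ℓ, ((ρ.config T).pc t).waits = some ℓ ∧ (ρ.config T).shared.holder ℓ ≠ none) ∨
    (((ρ.config T).pc t).InVM ∧ ((ρ.config (T + 1)).pc t).InVM) ∨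
    (((ρ.config T).pc t).Idle ∧ ((ρ.config (T + 1)).pc t).Idle)

theorem Run.pc_succ_of_ne {T : ℕ} {t : Fin m} (h : ρ.sched T ≠ some t) :
    (ρ.config (T + 1)).pc t = (ρ.config T).pc t := by
  obtain e | ⟨u, s', p', hu, -, e⟩ := ρ.config_succ T
  · rw [e]
  · rw [e]
    exact Function.update_of_ne (fun htu => h (by rw [hu, htu])) _ _

theorem Run.move {T : ℕ} {t : Fin m} (h : ρ.sched T = some t) :
    Move t (ρ.config T).shared ((ρ.config T).pc t) (ρ.config (T + 1)).shared
      ((ρ.config (T + 1)).pc t) := by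
  obtain ⟨q, hq, e⟩ := ρ.step_of_some T t h
  rw [e]
  simpa using Move.of_next hq

/-- The two indices and the count of their decreases are eventually constant. Once no status changes
any more, every thread contributes at most `PC.decreases` further decreases, and an index that does
not decrease any more is bounded by `n + m`. -/
theorem Run.eventually_index_eq : ∀ᶠ T in atTop,
    (ρ.config (T + 1)).shared.decreaseCnt = (ρ.config T).shared.decreaseCnt ∧
    (ρ.config (T + 1)).shared.validationIdx = (ρ.config T).shared.validationIdx ∧
    (ρ.config (T + 1)).shared.executionIdx = (ρ.config T).shared.executionIdx := by
  have hstage := eventually_all.2 fun j => ρ.eventually_stage_data_eq j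
  have hdecr : ∀ᶠ T in atTop, ∀ t,
      ((ρ.config (T + 1)).pc t).decreases = ((ρ.config T).pc t).decreases := by
    refine eventually_all.2 fun u => eventually_succ_eq_of_succ_le
      (f := fun T => ((ρ.config T).pc u).decreases) ?_
    filter_upwards [hstage] with T hT
    by_cases hu : ρ.sched T = some u
    · exact ((ρ.move hu).decreases_le ((ρ.invariant T).checked u)
        ((ρ.invariant T).executions_le u) fun i => (hT i).1).1
    · exact (congrArg _ (ρ.pc_succ_of_ne hu)).le
  have hmono : ∀ᶠ T in atTop,
      (ρ.config (T + 1)).shared.decreaseCnt = (ρ.config T).shared.decreaseCnt ∧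
      (ρ.config T).shared.validationIdx ≤ (ρ.config (T + 1)).shared.validationIdx ∧
      (ρ.config T).shared.executionIdx ≤ (ρ.config (T + 1)).shared.executionIdx := by
    filter_upwards [hstage, hdecr] with T hT hd
    cases hu : ρ.sched T with
    | none => simp [ρ.eq_of_none T hu]
    | some u =>
      have h := ((ρ.move hu).decreases_le ((ρ.invariant T).checked u)
        ((ρ.invariant T).executions_le u) fun i => (hT i).1).2
      rw [hd u] at h
      by_contra hne
      exact lt_irrefl _ (h (by omega))
  have hv := eventually_succ_eq_of_le_succ (f := fun T => (ρ.config T).shared.validationIdx)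
    (b := n + m) (.of_forall fun T => (Nat.le_add_right _ _).trans (ρ.invariant T).validationIdx)
    (hmono.mono fun T hT => hT.2.1)
  have he := eventually_succ_eq_of_le_succ (f := fun T => (ρ.config T).shared.executionIdx)
    (b := n + m) (.of_forall fun T => (Nat.le_add_right _ _).trans (ρ.invariant T).executionIdx)
    (hmono.mono fun T hT => hT.2.2)
  filter_upwards [hmono, hv, he] with T h1 h2 h3 using ⟨h1.1, h2, h3⟩

open Classical in
theorem Run.eventually_quietAt : ∀ᶠ T in atTop, ρ.QuietAt T := by
  have hstage := eventually_all.2 fun j => ρ.eventually_stage_data_eq j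
  have hidx := ρ.eventually_index_eq
  have hlt : ∀ᶠ T in atTop, ∀ t, ρ.sched T = some t → _ :=
    (hstage.and hidx).mono fun T hT t ht => (ρ.move ht).work_lt ((ρ.invariant T).checked t)
      ((ρ.invariant T).executions_le t) (ρ.invariant T).estimates (fun i => (hT.1 i).1)
      hT.2.2.1 hT.2.2.2
  have hwork : ∀ᶠ T in atTop, ∀ t,
      ((ρ.config (T + 1)).pc t).work
          (fun i => (ρ.config (T + 1)).shared.txnStatus i = .executed) =
        ((ρ.config T).pc t).work (fun i => (ρ.config T).shared.txnStatus i = .executed) := by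
    refine eventually_all.2 fun u => eventually_succ_eq_of_succ_le
      (f := fun T => ((ρ.config T).pc u).work
        (fun i => (ρ.config T).shared.txnStatus i = .executed)) ?_
    filter_upwards [hstage, hlt] with T hT hl
    simp only [fun i => (Shared.stage_eq_iff.1 (hT i).1).1]
    by_cases hu : ρ.sched T = some u
    · obtain h | h | h | h := hl u hu
      · convert h.le
      · rw [h.1]
      · rw [h.1.work_eq, h.2.work_eq]
      · rw [h.1.work_eq, h.2.work_eq]
    · rw [ρ.pc_succ_of_ne hu]
  filter_upwards [hstage, hidx, hlt, hwork] with T hT hi hl hw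
  refine ⟨hi.1, hi.2.1, hi.2.2, fun t ht => (hl t ht).resolve_left fun h => ?_⟩
  have hwt := hw t
  simp only [fun i => (Shared.stage_eq_iff.1 (hT i).1).1] at hwt
  refine h.ne ?_
  convert hwt

/-! ### All threads join -/

theorem Run.joinedAt_of_le {t : Fin m} {T T' : ℕ} (h : ρ.JoinedAt t T) (hT : T ≤ T') :
    ρ.JoinedAt t T' := by
  induction T', hT using Nat.le_induction with
  | base => exact h
  | succ T' hT ih =>
    unfold Run.JoinedAt at ih ⊢
    rwa [ρ.pc_succ_of_ne fun hs => ?_]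
    obtain ⟨q, hq, -⟩ := ρ.step_of_some T' t hs
    rw [ih] at hq
    exact hq

section Quiet

variable {ρ} {T₀ : ℕ} (hq : ∀ T ≥ T₀, ρ.QuietAt T)
include hq

theorem Run.idle_of_quiet {t : Fin m} (h : ((ρ.config T₀).pc t).Idle) {T : ℕ} (hT : T₀ ≤ T) :
    ((ρ.config T).pc t).Idle := by
  induction T, hT using Nat.le_induction with
  | base => exact h
  | succ T hT ih =>
    by_cases ht : ρ.sched T = some t
    · obtain h | h | h := (hq T hT).thread t ht
      · rwa [h.1]
      · cases hp : (ρ.config T).pc t <;> simp_all [PC.Idle, PC.InVM]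
      · exact h.2
    · rwa [ρ.pc_succ_of_ne ht]

theorem Run.not_inVM_of_quiet (hVM : VMExecuteWaitFree m B) (hρ : ρ.KeepsTakingSteps)
    (t : Fin m) : ¬ ((ρ.config T₀).pc t).InVM := by
  intro h
  have hin : ∀ T ≥ T₀, ((ρ.config T).pc t).InVM := by
    intro T hT
    induction T, hT using Nat.le_induction with
    | base => exact h
    | succ T hT ih =>
      by_cases ht : ρ.sched T = some t
      · obtain h | h | h := (hq T hT).thread t ht
        · rwa [h.1]
        · exact h.2
        · cases hp : (ρ.config T).pc t <;> simp_all [PC.Idle, PC.InVM]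
      · rwa [ρ.pc_succ_of_ne ht]
  have hj : ∀ T, ¬ ρ.JoinedAt t T := fun T hT => by
    have h' := hin _ (le_max_right T T₀)
    rw [ρ.joinedAt_of_le hT (le_max_left T T₀)] at h'
    exact h'
  obtain ⟨T, hT, hn⟩ := hVM ρ t (fun T => hρ t T (hj T)) T₀
  exact hn (hin T hT)

/-- A thread that is neither idle nor in the virtual machine waits for a lock, and its program
counter does not change. -/
theorem Run.exists_waits_of_quiet (hVM : VMExecuteWaitFree m B) (hρ : ρ.KeepsTakingSteps)
    {t : Fin m} (h : ¬ ((ρ.config T₀).pc t).Idle) :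
    (∀ T ≥ T₀, (ρ.config T).pc t = (ρ.config T₀).pc t) ∧
      ∃ T ≥ T₀, ∃ ℓ u, ((ρ.config T₀).pc t).waits = some ℓ ∧
        (ρ.config T).shared.holder ℓ = some u := by
  have hVM' := Run.not_inVM_of_quiet hq hVM hρ t
  have hpc : ∀ T ≥ T₀, (ρ.config T).pc t = (ρ.config T₀).pc t := by
    intro T hT
    induction T, hT using Nat.le_induction with
    | base => rfl
    | succ T hT ih =>
      by_cases ht : ρ.sched T = some t
      · obtain h' | h' | h' := (hq T hT).thread t ht
        · rw [h'.1, ih]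
        · exact absurd (ih ▸ h'.1) hVM'
        · exact absurd (ih ▸ h'.1) h
      · rwa [ρ.pc_succ_of_ne ht]
  refine ⟨hpc, ?_⟩
  obtain ⟨T, hT, ht⟩ := hρ t T₀ fun hj => h (by rw [hj]; trivial)
  obtain h' | h' | h' := (hq T hT).thread t ht
  · obtain ⟨-, ℓ, hw, hℓ⟩ := h'
    obtain ⟨u, hu⟩ := Option.ne_none_iff_exists'.1 hℓ
    exact ⟨T, hT, ℓ, u, hpc T hT ▸ hw, hu⟩
  · exact absurd (hpc T hT ▸ h'.1) hVM'
  · exact absurd (hpc T hT ▸ h'.1) h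

/-- There is no deadlock: a thread that waits forever would wait for a lock whose holder waits
forever for the lock of a status, and whoever holds a lock of a status does not wait. -/
theorem Run.all_idle_of_quiet (hVM : VMExecuteWaitFree m B) (hρ : ρ.KeepsTakingSteps)
    (t : Fin m) : ((ρ.config T₀).pc t).Idle := by
  have key : ∀ {u : Fin m} {T : ℕ} {ℓ : Lock n}, T₀ ≤ T →
      (ρ.config T).shared.holder ℓ = some u →
      ¬ ((ρ.config T₀).pc u).Idle ∧ ((ρ.config T₀).pc u).Holds ℓ := by
    intro u T ℓ hT hu
    have hh := ((ρ.invariant T).holder u ℓ).1 hu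
    have hi : ¬ ((ρ.config T₀).pc u).Idle := fun hi => hh.not_idle (Run.idle_of_quiet hq hi hT)
    exact ⟨hi, (Run.exists_waits_of_quiet hq hVM hρ hi).1 T hT ▸ hh⟩
  by_contra h
  obtain ⟨-, T, hT, ℓ, u, -, hu⟩ := Run.exists_waits_of_quiet hq hVM hρ h
  obtain ⟨hi, hh⟩ := key hT hu
  obtain ⟨-, T', hT', ℓ', u', hw, hu'⟩ := Run.exists_waits_of_quiet hq hVM hρ hi
  obtain ⟨hi', hh'⟩ := key hT' hu'
  obtain ⟨j, rfl⟩ := (hh.of_waits hw).2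
  obtain ⟨-, -, -, ℓ'', -, hw', -⟩ := Run.exists_waits_of_quiet hq hVM hρ hi'
  obtain ⟨b, hb⟩ := (hh'.of_waits hw').1
  exact absurd hb (by simp)

end Quiet

/-- A thread that is idle in a quiet period joins: if the done marker is not set, then both indices
are at least `n`, there is no active task, and the thread passes all checks of `check_done`. -/
theorem Run.exists_joinedAt_of_quiet {T₀ : ℕ} (hq : ∀ T ≥ T₀, ρ.QuietAt T)
    (hidle : ∀ T ≥ T₀, ∀ t, ((ρ.config T).pc t).Idle) (hρ : ρ.KeepsTakingSteps) (t : Fin m) :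
    ∃ T, ρ.JoinedAt t T := by
  by_contra! hj
  have hV := eq_of_succ_eq (f := fun T => (ρ.config T).shared.validationIdx)
    fun T hT => (hq T hT).validationIdx
  have hE := eq_of_succ_eq (f := fun T => (ρ.config T).shared.executionIdx)
    fun T hT => (hq T hT).executionIdx
  have hC := eq_of_succ_eq (f := fun T => (ρ.config T).shared.decreaseCnt)
    fun T hT => (hq T hT).decreaseCnt
  -- the next step of the thread after time `T`
  have hstep : ∀ T ≥ T₀, ∃ T' ≥ T₀, T ≤ T' ∧ ∃ s' p', (ρ.config (T' + 1)).shared = s' ∧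
      (ρ.config (T' + 1)).pc t = p' ∧ p'.Idle ∧
      Move t (ρ.config T').shared ((ρ.config T).pc t) s' p' := by
    intro T hT
    have hex : ∃ T', T ≤ T' ∧ ρ.sched T' = some t := by
      obtain ⟨T', h1, h2⟩ := hρ t T (hj T)
      exact ⟨T', h1, h2⟩
    classical
    obtain ⟨h1, h2⟩ := Nat.find_spec hex
    have hpc : ∀ U ≥ T, U ≤ Nat.find hex → (ρ.config U).pc t = (ρ.config T).pc t := by
      intro U hU
      induction U, hU using Nat.le_induction with
      | base => exact fun _ => rfl
      | succ U hU ih =>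
        intro hle
        rw [ρ.pc_succ_of_ne fun h => Nat.find_min hex (m := U) (by omega) ⟨hU, h⟩]
        exact ih (by omega)
    refine ⟨_, hT.trans h1, h1, _, _, rfl, rfl, hidle _ (by omega) t, ?_⟩
    exact hpc _ h1 le_rfl ▸ ρ.move h2
  have hloop : ∀ d, ∀ T ≥ T₀, ((ρ.config T).pc t).idleDistance = d →
      ∃ T' ≥ T₀, T ≤ T' ∧ (ρ.config T').pc t = .loop none := by
    intro d
    induction d using Nat.strong_induction_on with
    | _ d ih =>
      intro T hT hd
      by_cases hp : (ρ.config T).pc t = .loop none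
      · exact ⟨T, hT, le_rfl, hp⟩
      obtain ⟨T₁, hT₁, hle, s', p', -, hp', hi, h⟩ := hstep T hT
      have hlt := h.idleDistance_lt (hidle T hT t) hi hp
      obtain ⟨T₂, hT₂, hle', h₂⟩ := ih _ (hd ▸ hlt) (T₁ + 1) (by omega) (by rw [hp'])
      exact ⟨T₂, hT₂, by omega, h₂⟩
  have hnotDone : ∀ T, (ρ.config T).shared.doneMarker = false := by
    intro T
    by_contra hd
    rw [Bool.not_eq_false] at hd
    have hd' : ∀ T' ≥ T, (ρ.config T').shared.doneMarker = true := by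
      intro T' hT'
      induction T', hT' using Nat.le_induction with
      | base => exact hd
      | succ T' hT' ih =>
        cases hs : ρ.sched T' with
        | none => rwa [ρ.eq_of_none T' hs]
        | some u => exact (ρ.move hs).doneMarker ih
    obtain ⟨T₁, hT₁, hle, h₁⟩ := hloop _ (max T T₀) (le_max_right _ _) rfl
    obtain ⟨T₂, hT₂, hle₂, s', p', -, hp', -, h⟩ := hstep T₁ hT₁
    have hd₂ := hd' T₂ (by omega)
    rw [h₁] at h
    cases h
    case blocked hw => simp [PC.waits] at hw
    case join => exact hj _ hp'
    case askTask h => simp [hd₂] at h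
  have hactive : ∀ T ≥ T₀, (ρ.config T).shared.numActiveTasks = 0 := by
    intro T hT
    rw [(ρ.invariant T).active (hnotDone T)]
    exact Finset.sum_eq_zero fun u _ => (hidle T hT u).active_eq
  obtain ⟨T, hT, -, hp⟩ := hloop _ T₀ le_rfl rfl
  -- from the loop condition to the comparison of the current indices
  obtain ⟨T₁, hT₁, -, s', p', -, hp', hi, h⟩ := hstep T hT
  rw [hp] at h
  cases h
  case blocked hw => simp [PC.waits] at hw
  case join => exact hj _ hp'
  obtain ⟨T₂, hT₂, -, s', p'', -, hp'', hi, h⟩ := hstep (T₁ + 1) (by omega)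
  rw [hp'] at h
  cases h
  case blocked hw => simp [PC.waits] at hw
  obtain ⟨T₃, hT₃, -, s', p', -, hp', hi, h⟩ := hstep (T₂ + 1) (by omega)
  rw [hp''] at h
  have hV₂ := hV T₂ hT₂
  have hV₃ := hV T₃ hT₃
  have hE₃ := hE T₃ hT₃
  -- the smaller index is at least `n`, as the thread does not fetch it
  obtain ⟨T₄, hT₄, hp₄, hnV, hnE⟩ : ∃ T ≥ T₀, (ρ.config T).pc t = .cdCount ∧
      n ≤ (ρ.config T₀).shared.validationIdx ∧ n ≤ (ρ.config T₀).shared.executionIdx := by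
    cases h
    case blocked hw => simp [PC.waits] at hw
    case compareLt hlt =>
      obtain ⟨T₄, hT₄, -, s', p'', -, hp'', hi, h⟩ := hstep (T₃ + 1) (by omega)
      rw [hp'] at h
      have hV₄ := hV T₄ hT₄
      cases h
      case blocked hw => simp [PC.waits] at hw
      case nvvCheck => exact hi.elim
      case nvvCheckDone hn => exact ⟨T₄ + 1, by omega, hp'', by omega, by omega⟩
    case compareGe hge =>
      obtain ⟨T₄, hT₄, -, s', p'', -, hp'', hi, h⟩ := hstep (T₃ + 1) (by omega)
      rw [hp'] at h
      have hE₄ := hE T₄ hT₄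
      cases h
      case blocked hw => simp [PC.waits] at hw
      case nveCheck => exact hi.elim
      case nveCheckDone hn => exact ⟨T₄ + 1, by omega, hp'', by omega, by omega⟩
  -- the checks succeed
  obtain ⟨T₅, hT₅, -, s', p', -, hp₅, -, h⟩ := hstep T₄ hT₄
  rw [hp₄] at h
  cases h
  case blocked hw => simp [PC.waits] at hw
  obtain ⟨T₆, hT₆, -, s', p', -, hp₆, -, h⟩ := hstep (T₅ + 1) (by omega)
  have hE₆ := hE T₆ hT₆
  rw [hp₅] at h
  cases h
  case blocked hw => simp [PC.waits] at hw
  case cdExecutionIdxFail h => omega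
  obtain ⟨T₇, hT₇, -, s', p', -, hp₇, -, h⟩ := hstep (T₆ + 1) (by omega)
  have hV₇ := hV T₇ hT₇
  rw [hp₆] at h
  cases h
  case blocked hw => simp [PC.waits] at hw
  case cdValidationIdxFail h => omega
  obtain ⟨T₈, hT₈, -, s', p', -, hp₈, -, h⟩ := hstep (T₇ + 1) (by omega)
  rw [hp₇] at h
  cases h
  case blocked hw => simp [PC.waits] at hw
  case cdActiveFail h => exact h (hactive T₈ hT₈)
  obtain ⟨T₉, hT₉, -, s', p', -, hp₉, -, h⟩ := hstep (T₈ + 1) (by omega)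
  rw [hp₈] at h
  cases h
  case blocked hw => simp [PC.waits] at hw
  case cdRecountFail h => exact h ((hC T₅ hT₅).trans (hC T₉ hT₉).symm)
  obtain ⟨T₁₀, -, -, s', p', hs', -, -, h⟩ := hstep (T₉ + 1) (by omega)
  rw [hp₉] at h
  have hd := hnotDone (T₁₀ + 1)
  rw [hs'] at hd
  cases h
  case blocked hw => simp [PC.waits] at hw
  case cdSet => simp at hd

end Liveness

end BlockSTM

theorem mainTheorem3 {m n : ℕ} {Loc Val σ : Type*} [DecidableEq Loc] [DecidableEq Val]
    (B : BlockSTM.Block n Loc Val σ) (hVM : BlockSTM.VMExecuteWaitFree m B)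
    (ρ : BlockSTM.Run m B) (hρ : ρ.KeepsTakingSteps) :
    ∀ t : Fin m, ∃ T : ℕ, ∀ T' ≥ T, ρ.JoinedAt t T' := by
  intro t
  obtain ⟨T₀, hq⟩ := Filter.eventually_atTop.1 ρ.eventually_quietAt
  have hidle : ∀ T ≥ T₀, ∀ t, ((ρ.config T).pc t).Idle := fun T hT =>
    BlockSTM.Run.all_idle_of_quiet (fun T' hT' => hq T' (hT.trans hT')) hVM hρ
  obtain ⟨T, hT⟩ := ρ.exists_joinedAt_of_quiet hq hidle hρ t
  exact ⟨T, fun T' hT' => ρ.joinedAt_of_le hT hT'⟩
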